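/- Let $\alpha\in(1,2)$ and let $X$ be a symmetric $\alpha$-stable real random variable with Lévy measure $|x|^{-\alpha-1}\,dx$, i.e. with characteristic function $$\mathbb{E}\,e^{itX}=\exp\left(\int_{-\infty}^{+\infty}\bigl(e^{itx}-1-itx\bigr)\frac{dx}{|x|^{\alpha+1}}\right),\qquad t\in\mathbb{R}.$$ For every $y\in\left[\frac{2}{\sqrt{2-\alpha}},\frac{2}{2-\alpha}\right]$ one has $$\mathbb{P}(X\ge 2y)\le\frac{10}{3}\,\frac{1}{y^{\alpha}}+e^{\frac{2}{45}}e^{-\frac14(2-\alpha)y^2}$$ and $$\mathbb{P}\left(X\ge\frac{\sqrt2}{4}\,y\right)\ge\frac{1}{6e^{5}}\,\frac{1}{y^{\alpha}}+\frac{1}{6e}\,e^{-(2-\alpha)y^2},$$ while for every $y\ge\frac{2}{2-\alpha}$ one has $$\mathbb{P}(X\ge 2y)\le\frac{16}{3}\,\frac{1}{y^{\alpha}}\qquad\text{and}\qquad \mathbb{P}(X\ge y)\ge\frac12\,\frac{1}{2+\alpha y^{\alpha}}.$$ -/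

import Mathlib

open MeasureTheory

/-- The symmetric `α`-stable Lévy measure `ν(dx) = |x|^{-α-1} dx` on `ℝ`. -/
noncomputable def symmetricStableLevyMeasure (α : ℝ) : Measure ℝ :=
  volume.withDensity fun x : ℝ => ENNReal.ofReal (|x| ^ (-α - 1))

/-- For `α ∈ (1, 2)`: `X` is, under `P`, a symmetric `α`-stable random variable with
Lévy measure `|x|^{-α-1} dx`, i.e. its characteristic function is
`E exp(itX) = exp (∫ (e^{itx} - 1 - itx) |x|^{-α-1} dx)`. The compensator `itx` makes the
integral absolutely convergent for `α ∈ (1, 2)`; it drops out by symmetry if the integral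
is read as a principal value. -/
structure IsSymmetricStable {Ω : Type*} [MeasurableSpace Ω] (P : Measure Ω) (α : ℝ)
    (X : Ω → ℝ) : Prop where
  aemeasurable : AEMeasurable X P
  charFun_eq : ∀ t : ℝ, charFun (P.map X) t =
    Complex.exp (∫ x : ℝ, (Complex.exp (t * x * Complex.I) - 1 - t * x * Complex.I)
      ∂(symmetricStableLevyMeasure α))

open Filter Topology Set
open scoped ENNReal Nat

/-! The law of `X` is the weak limit, as `δ → 0`, of the compound Poisson laws whose Lévy measure is
`|x|^{-α-1} dx` cut to `|x| > δ`. For these the jumps in disjoint regions are independent and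
exponential moments are explicit, so every tail bound is proved there with constants free of `δ` and
passed to the limit by the portmanteau theorem.

Upper bounds. Cut the jumps at `R = y`. A jump above `y` occurs with probability at most `y^{-α}/α`.
The remaining jumps are treated by Chernoff's bound at `s = u/y`, with exponent at most `-2u +
u²/((2-α)y^α) + e^u/(2y^α)` at the level `2y` (`real_two_mul_le`). Write `T = (2-α)y²`. The choice
`u = log y^α` gives a multiple of `y^{-α}` whenever `log y^α ≤ (2-α)y^α`, which holds for all `y ≥
2/(2-α)` (`log_le_mul_rpow`). In the intermediate range `y^{2-α} ≤ 2.1`, so `y²` and `y^α` are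
comparable; `u` is then the smaller of `T/4` and `log y^α`, and `T/4` produces the Gaussian term.

Lower bounds. The power term comes from a single large jump: by symmetry the other jumps do not
cancel it with probability at least one half (`half_mul_one_sub_exp_le_conv`). The Gaussian term
comes from the jumps of size at most `1`: Paley–Zygmund is applied to `exp (sX)` with `s =
(2-α)y/2`, and restoring the larger jumps costs a factor `1/2`. The intermediate lower bound is a
weighted mean of the two. -/

/-! ### Compound Poisson laws -/

/-- The `k`-fold convolution power of a measure on `ℝ`. -/
noncomputable def convPow (ν : Measure ℝ) : ℕ → Measure ℝ
  | 0 => Measure.dirac 0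
  | k + 1 => ν ∗ convPow ν k

/-- The compound Poisson law with finite Lévy measure `ν`. -/
noncomputable def compoundPoisson (ν : Measure ℝ) : Measure ℝ :=
  Measure.sum fun k : ℕ => ENNReal.ofReal (Real.exp (-ν.real univ) / k !) • convPow ν k

instance isFiniteMeasure_convPow (ν : Measure ℝ) [IsFiniteMeasure ν] (k : ℕ) :
    IsFiniteMeasure (convPow ν k) := by
  induction k with
  | zero => unfold convPow; infer_instance
  | succ k ih => unfold convPow; infer_instance

theorem charFun_convPow (ν : Measure ℝ) [IsFiniteMeasure ν] (k : ℕ) (t : ℝ) :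
    charFun (convPow ν k) t = charFun ν t ^ k := by
  induction k with
  | zero => simp [convPow]
  | succ k ih => rw [convPow, charFun_conv, ih, pow_succ']

theorem lintegral_exp_conv (μ ν : Measure ℝ) [SFinite ν] (s : ℝ) :
    ∫⁻ x, ENNReal.ofReal (Real.exp (s * x)) ∂(μ ∗ ν) =
      (∫⁻ x, ENNReal.ofReal (Real.exp (s * x)) ∂μ) *
        ∫⁻ x, ENNReal.ofReal (Real.exp (s * x)) ∂ν := by
  rw [Measure.lintegral_conv (by fun_prop), ← lintegral_mul_const _ (by fun_prop)]
  refine lintegral_congr fun x => ?_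
  rw [← lintegral_const_mul _ (by fun_prop)]
  refine lintegral_congr fun z => ?_
  rw [mul_add, Real.exp_add, ENNReal.ofReal_mul (Real.exp_pos _).le]

theorem lintegral_exp_convPow (ν : Measure ℝ) [IsFiniteMeasure ν] (k : ℕ) (s : ℝ) :
    ∫⁻ x, ENNReal.ofReal (Real.exp (s * x)) ∂(convPow ν k) =
      (∫⁻ x, ENNReal.ofReal (Real.exp (s * x)) ∂ν) ^ k := by
  induction k with
  | zero => simp [convPow, lintegral_dirac]
  | succ k ih => rw [convPow, lintegral_exp_conv, ih, pow_succ']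

theorem lintegral_exp_compoundPoisson {ν : Measure ℝ} [IsFiniteMeasure ν] {s : ℝ}
    (hs : Integrable (fun x => Real.exp (s * x)) ν) :
    ∫⁻ x, ENNReal.ofReal (Real.exp (s * x)) ∂(compoundPoisson ν) =
      ENNReal.ofReal (Real.exp (∫ x, (Real.exp (s * x) - 1) ∂ν)) := by
  have h0 : ∫⁻ x, ENNReal.ofReal (Real.exp (s * x)) ∂ν =
      ENNReal.ofReal (∫ x, Real.exp (s * x) ∂ν) :=
    (ofReal_integral_eq_lintegral_ofReal hs (ae_of_all _ fun x => (Real.exp_pos _).le)).symm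
  have hI : 0 ≤ ∫ x, Real.exp (s * x) ∂ν := integral_nonneg fun x => (Real.exp_pos _).le
  have hexp := NormedSpace.expSeries_div_hasSum_exp (𝔸 := ℝ) (∫ x, Real.exp (s * x) ∂ν)
  rw [← Real.exp_eq_exp_ℝ] at hexp
  have hexp' := hexp.mul_left (Real.exp (-ν.real univ))
  rw [compoundPoisson, lintegral_sum_measure]
  simp_rw [lintegral_smul_measure, lintegral_exp_convPow, h0, smul_eq_mul,
    ← ENNReal.ofReal_pow hI]
  have : ∀ k : ℕ, ENNReal.ofReal (Real.exp (-ν.real univ) / k !) *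
      ENNReal.ofReal ((∫ x, Real.exp (s * x) ∂ν) ^ k) =
      ENNReal.ofReal (Real.exp (-ν.real univ) * ((∫ x, Real.exp (s * x) ∂ν) ^ k / k !)) := by
    intro k
    rw [← ENNReal.ofReal_mul (by positivity)]
    congr 1
    ring
  simp_rw [this]
  rw [← ENNReal.ofReal_tsum_of_nonneg (fun k => by positivity) hexp'.summable, hexp'.tsum_eq,
    ← Real.exp_add, integral_sub hs (integrable_const _)]
  simp only [integral_const, smul_eq_mul, mul_one]
  ring_nf

instance isProbabilityMeasure_compoundPoisson (ν : Measure ℝ) [IsFiniteMeasure ν] :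
    IsProbabilityMeasure (compoundPoisson ν) := by
  have h := lintegral_exp_compoundPoisson (ν := ν) (s := 0) (by simp)
  constructor
  simpa using h

theorem charFun_compoundPoisson (ν : Measure ℝ) [IsFiniteMeasure ν] (t : ℝ) :
    charFun (compoundPoisson ν) t =
      Complex.exp (∫ x, (Complex.exp (t * x * Complex.I) - 1) ∂ν) := by
  have hint : ∀ (μ : Measure ℝ) [IsFiniteMeasure μ],
      Integrable (fun x : ℝ => Complex.exp (t * x * Complex.I)) μ := by
    intro μ _
    refine Integrable.of_bound (by fun_prop) 1 (ae_of_all _ fun x => ?_)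
    rw [← Complex.ofReal_mul, Complex.norm_exp_ofReal_mul_I]
  have hs := hasSum_integral_measure (hint (compoundPoisson ν))
  have hI : ∫ x : ℝ, Complex.exp (t * x * Complex.I) ∂ν = charFun ν t := (charFun_apply_real t).symm
  have hexp := (NormedSpace.expSeries_div_hasSum_exp (𝔸 := ℂ) (charFun ν t)).mul_left
    (Complex.exp (-(ν.real univ : ℝ)))
  rw [← Complex.exp_eq_exp_ℂ] at hexp
  rw [charFun_apply_real, compoundPoisson, ← hs.tsum_eq, integral_sub (hint ν) (integrable_const _), hI]
  have hterm : ∀ k : ℕ, ∫ x : ℝ, Complex.exp (t * x * Complex.I)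
      ∂(ENNReal.ofReal (Real.exp (-ν.real univ) / k !) • convPow ν k) =
      Complex.exp (-(ν.real univ : ℝ)) * (charFun ν t ^ k / k !) := by
    intro k
    rw [integral_smul_measure, ← charFun_apply_real, charFun_convPow,
      ENNReal.toReal_ofReal (by positivity), Complex.real_smul]
    push_cast
    ring
  simp_rw [hterm]
  rw [hexp.tsum_eq, ← Complex.exp_add]
  simp only [integral_const, Complex.real_smul, mul_one]
  ring_nf

/-- The exponents of the characteristic functions add. This is the device that makes jumps of
different sizes independent. -/
theorem compoundPoisson_add (ν₁ ν₂ : Measure ℝ) [IsFiniteMeasure ν₁] [IsFiniteMeasure ν₂] :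
    compoundPoisson (ν₁ + ν₂) = compoundPoisson ν₁ ∗ compoundPoisson ν₂ := by
  refine Measure.ext_of_charFun (funext fun t => ?_)
  have hint : ∀ (μ : Measure ℝ) [IsFiniteMeasure μ],
      Integrable (fun x : ℝ => Complex.exp (t * x * Complex.I) - 1) μ := by
    intro μ _
    refine (Integrable.of_bound (by fun_prop) 1 (ae_of_all _ fun x => ?_)).sub (integrable_const _)
    rw [← Complex.ofReal_mul, Complex.norm_exp_ofReal_mul_I]
  rw [charFun_conv, charFun_compoundPoisson, charFun_compoundPoisson, charFun_compoundPoisson,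
    ← Complex.exp_add, integral_add_measure (hint _) (hint _)]

theorem integrable_exp_compoundPoisson {ν : Measure ℝ} [IsFiniteMeasure ν] {s : ℝ}
    (hs : Integrable (fun x => Real.exp (s * x)) ν) :
    Integrable (fun x => Real.exp (s * x)) (compoundPoisson ν) := by
  refine ⟨by fun_prop, ?_⟩
  rw [hasFiniteIntegral_iff_ofReal (ae_of_all _ fun x => (Real.exp_pos _).le),
    lintegral_exp_compoundPoisson hs]
  exact ENNReal.ofReal_lt_top

theorem integral_exp_compoundPoisson {ν : Measure ℝ} [IsFiniteMeasure ν] {s : ℝ}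
    (hs : Integrable (fun x => Real.exp (s * x)) ν) :
    ∫ x, Real.exp (s * x) ∂(compoundPoisson ν) =
      Real.exp (∫ x, (Real.exp (s * x) - 1) ∂ν) := by
  rw [integral_eq_lintegral_of_nonneg_ae (ae_of_all _ fun x => (Real.exp_pos _).le) (by fun_prop),
    lintegral_exp_compoundPoisson hs, ENNReal.toReal_ofReal (Real.exp_pos _).le]

theorem smul_dirac_le_compoundPoisson (ν : Measure ℝ) :
    ENNReal.ofReal (Real.exp (-ν.real univ)) • Measure.dirac 0 ≤ compoundPoisson ν := by
  have h := Measure.le_sum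
    (fun k : ℕ => ENNReal.ofReal (Real.exp (-ν.real univ) / k !) • convPow ν k) 0
  simpa [convPow, compoundPoisson] using h

/-! ### Symmetric measures -/

theorem isNegInvariant_of_charFun_neg {μ : Measure ℝ} [IsFiniteMeasure μ]
    (h : ∀ t, charFun μ (-t) = charFun μ t) : μ.IsNegInvariant := by
  constructor
  have : IsFiniteMeasure μ.neg := by unfold Measure.neg; infer_instance
  refine Measure.ext_of_charFun (funext fun t => ?_)
  rw [← h t, Measure.neg, charFun_apply_real, charFun_apply_real,
    integral_map (by fun_prop) (by fun_prop)]
  simp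

theorem charFun_neg_eq_self (μ : Measure ℝ) [μ.IsNegInvariant] (t : ℝ) :
    charFun μ (-t) = charFun μ t := by
  rw [charFun_apply_real, charFun_apply_real, ← integral_neg_eq_self]
  simp

instance isNegInvariant_conv (μ ν : Measure ℝ) [IsFiniteMeasure μ] [IsFiniteMeasure ν]
    [μ.IsNegInvariant] [ν.IsNegInvariant] : (μ ∗ ν).IsNegInvariant :=
  isNegInvariant_of_charFun_neg fun t => by
    rw [charFun_conv, charFun_conv, charFun_neg_eq_self, charFun_neg_eq_self]

instance isNegInvariant_convPow (ν : Measure ℝ) [IsFiniteMeasure ν] [ν.IsNegInvariant] (k : ℕ) :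
    (convPow ν k).IsNegInvariant :=
  isNegInvariant_of_charFun_neg fun t => by
    rw [charFun_convPow, charFun_convPow, charFun_neg_eq_self]

instance isNegInvariant_compoundPoisson (ν : Measure ℝ) [IsFiniteMeasure ν] [ν.IsNegInvariant] :
    (compoundPoisson ν).IsNegInvariant :=
  isNegInvariant_of_charFun_neg fun t => by
    rw [charFun_compoundPoisson, charFun_compoundPoisson]
    congr 1
    rw [← integral_neg_eq_self]
    simp

theorem measure_Iic_neg_eq (μ : Measure ℝ) [μ.IsNegInvariant] (y : ℝ) :
    μ (Iic (-y)) = μ (Ici y) := by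
  rw [← Measure.measure_preimage_neg μ (Ici y)]
  congr 1
  ext x
  simp

theorem half_le_real_Ici_zero (ρ : Measure ℝ) [IsProbabilityMeasure ρ] [ρ.IsNegInvariant] :
    1 / 2 ≤ ρ.real (Ici 0) := by
  have h1 : ρ.real (Iic 0) = ρ.real (Ici 0) := by
    have := measure_Iic_neg_eq ρ 0
    rw [neg_zero] at this
    simp [measureReal_def, this]
  have h2 := measureReal_union_le (μ := ρ) (Iic (0 : ℝ)) (Ici 0)
  rw [Iic_union_Ici, probReal_univ] at h2
  linarith

theorem real_le_abs_eq_two_mul (μ : Measure ℝ) [IsFiniteMeasure μ] [μ.IsNegInvariant] {y : ℝ}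
    (hy : 0 < y) : μ.real {x | y ≤ |x|} = 2 * μ.real (Ici y) := by
  have h1 : {x : ℝ | y ≤ |x|} = Iic (-y) ∪ Ici y := by
    ext x
    simp only [mem_ofPred_eq, mem_union, mem_Iic, mem_Ici, le_abs, le_neg]
    tauto
  have hd : Disjoint (Iic (-y)) (Ici y) := by
    rw [Set.disjoint_left]
    intro x hx hx'
    simp only [mem_Iic, mem_Ici] at hx hx'
    linarith
  rw [h1, measureReal_union hd measurableSet_Ici, measureReal_def, measure_Iic_neg_eq,
    ← measureReal_def]
  ring

/-! ### Tails of convolutions -/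

theorem conv_apply_eq_lintegral (μ ρ : Measure ℝ) [SFinite ρ] {s : Set ℝ} (hs : MeasurableSet s) :
    (μ ∗ ρ) s = ∫⁻ x, ρ ((fun w => x + w) ⁻¹' s) ∂μ := by
  rw [← lintegral_indicator_one hs, Measure.lintegral_conv (by fun_prop (disch := assumption))]
  refine lintegral_congr fun x => ?_
  rw [← lintegral_indicator_one (measurable_const_add x hs)]
  rfl

/-- Adding an independent symmetric variable at most halves an upper tail. -/
theorem half_mul_real_Ici_le_conv (μ ρ : Measure ℝ) [IsProbabilityMeasure μ]
    [IsProbabilityMeasure ρ] [ρ.IsNegInvariant] (a : ℝ) :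
    1 / 2 * μ.real (Ici a) ≤ (μ ∗ ρ).real (Ici a) := by
  have h : μ (Ici a) * ρ (Ici 0) ≤ (μ ∗ ρ) (Ici a) := by
    rw [conv_apply_eq_lintegral μ ρ measurableSet_Ici, mul_comm, ← setLIntegral_const]
    refine le_trans (setLIntegral_mono' measurableSet_Ici fun x hx => ?_)
      (setLIntegral_le_lintegral (Ici a) _)
    refine measure_mono fun w hw => ?_
    simp only [mem_preimage, mem_Ici] at *
    linarith
  have h' := ENNReal.toReal_mono (measure_ne_top _ _) h
  rw [ENNReal.toReal_mul] at h'
  refine le_trans ?_ h'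
  rw [mul_comm]
  exact mul_le_mul_of_nonneg_left (half_le_real_Ici_zero ρ) ENNReal.toReal_nonneg

/-- If `|x| ≥ y`, then `x + w` and `x - w` cannot both lie in `(-y, y)`, since their mean is `x`.
Symmetry of `ρ` gives the two events equal mass. -/
theorem half_mul_le_conv_le_abs (ν ρ : Measure ℝ) [IsFiniteMeasure ν] [IsFiniteMeasure ρ]
    [ρ.IsNegInvariant] {y : ℝ} (hν : ∀ᵐ x ∂ν, y ≤ |x|) :
    2⁻¹ * (ρ univ * ν univ) ≤ (ν ∗ ρ) {x | y ≤ |x|} := by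
  have hm : MeasurableSet {x : ℝ | y ≤ |x|} := measurableSet_le measurable_const (by fun_prop)
  rw [conv_apply_eq_lintegral ν ρ hm, ← mul_assoc, ← lintegral_const]
  refine lintegral_mono_ae ?_
  filter_upwards [hν] with x hx
  have hneg : ρ {w | y ≤ |x - w|} = ρ ((fun w => x + w) ⁻¹' {x | y ≤ |x|}) := by
    rw [← Measure.measure_preimage_neg ρ {w | y ≤ |x - w|}]
    simp
  have hcover : (univ : Set ℝ) ⊆ ((fun w => x + w) ⁻¹' {x | y ≤ |x|}) ∪ {w | y ≤ |x - w|} := by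
    intro w _
    by_contra hw
    simp only [mem_union, mem_preimage, mem_ofPred_eq, not_or, not_le, abs_lt] at hw
    rcases le_abs.1 hx with h | h <;> linarith [hw.1.1, hw.1.2, hw.2.1, hw.2.2]
  have h2 : ρ univ ≤ 2 * ρ ((fun w => x + w) ⁻¹' {x | y ≤ |x|}) := by
    refine (measure_mono hcover).trans ((measure_union_le _ _).trans ?_)
    rw [hneg, two_mul]
  calc 2⁻¹ * ρ univ ≤ 2⁻¹ * (2 * ρ ((fun w => x + w) ⁻¹' {x | y ≤ |x|})) := by gcongr
    _ = _ := by rw [← mul_assoc, ENNReal.inv_mul_cancel (by simp) (by simp), one_mul]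

theorem convPow_univ (ν : Measure ℝ) [IsFiniteMeasure ν] (k : ℕ) :
    convPow ν k univ = ν univ ^ k := by
  simpa using lintegral_exp_convPow ν k 0

/-- Lévy-type inequality: a symmetric compound Poisson variable all of whose jumps are at least
`y` in absolute value, plus an independent symmetric variable, is at least `y` in absolute value
with at least half the probability of having a jump. -/
theorem half_mul_one_sub_exp_le_conv (ν ρ : Measure ℝ) [IsFiniteMeasure ν]
    [IsProbabilityMeasure ρ] [ν.IsNegInvariant] [ρ.IsNegInvariant] {y : ℝ}
    (hν : ∀ᵐ x ∂ν, y ≤ |x|) :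
    1 / 2 * (1 - Real.exp (-ν.real univ)) ≤ (compoundPoisson ν ∗ ρ).real {x | y ≤ |x|} := by
  have hm : MeasurableSet {x : ℝ | y ≤ |x|} := measurableSet_le measurable_const (by fun_prop)
  set c : ℕ → ℝ≥0∞ := fun k => ENNReal.ofReal (Real.exp (-ν.real univ) / k !) with hc
  have htot : 1 = ∑' k, c k * ν univ ^ k := by
    have h := measure_univ (μ := compoundPoisson ν)
    rw [compoundPoisson, Measure.sum_apply _ MeasurableSet.univ] at h
    simp only [Measure.smul_apply, convPow_univ, smul_eq_mul] at h
    exact h.symm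
  have hexp : (compoundPoisson ν ∗ ρ) {x | y ≤ |x|} =
      ∑' k, c k * (convPow ν k ∗ ρ) {x | y ≤ |x|} := by
    rw [conv_apply_eq_lintegral _ _ hm, compoundPoisson, lintegral_sum_measure]
    refine tsum_congr fun k => ?_
    rw [lintegral_smul_measure, conv_apply_eq_lintegral _ _ hm, smul_eq_mul]
  have hk : ∀ k, 2⁻¹ * (c (k + 1) * ν univ ^ (k + 1)) ≤
      c (k + 1) * (convPow ν (k + 1) ∗ ρ) {x | y ≤ |x|} := by
    intro k
    -- One large jump is singled out; the other `k` jumps together with `ρ` form a symmetric law to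
    -- which the one-jump inequality applies.
    rw [convPow, Measure.conv_assoc]
    have h := half_mul_le_conv_le_abs ν (convPow ν k ∗ ρ) hν
    have hu : (convPow ν k ∗ ρ) univ = ν univ ^ k := by
      have := lintegral_exp_conv (convPow ν k) ρ 0
      simpa [convPow_univ] using this
    rw [hu, ← pow_succ] at h
    calc _ = c (k + 1) * (2⁻¹ * ν univ ^ (k + 1)) := by ring
      _ ≤ _ := by gcongr
  have hsum : 2⁻¹ * ∑' k, c (k + 1) * ν univ ^ (k + 1) ≤
      (compoundPoisson ν ∗ ρ) {x | y ≤ |x|} := by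
    rw [hexp, ← ENNReal.tsum_mul_left, tsum_eq_zero_add'
      (f := fun k => c k * (convPow ν k ∗ ρ) {x | y ≤ |x|}) ENNReal.summable]
    exact le_add_left (ENNReal.tsum_le_tsum hk)
  rw [tsum_eq_zero_add' ENNReal.summable] at htot
  have hS : ∑' k, c (k + 1) * ν univ ^ (k + 1) ≠ ⊤ := fun h => by simp [h] at htot
  have h1 := congrArg ENNReal.toReal htot
  have h2 := ENNReal.toReal_mono (measure_ne_top _ _) hsum
  rw [ENNReal.toReal_add (by simp [hc]) hS] at h1
  have hc0 : (c 0 * ν univ ^ 0).toReal = Real.exp (-ν.real univ) := by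
    simp [hc, ENNReal.toReal_ofReal (Real.exp_pos _).le]
  rw [hc0, ENNReal.toReal_one] at h1
  rw [ENNReal.toReal_mul, ENNReal.toReal_inv, ENNReal.toReal_ofNat] at h2
  refine le_trans ?_ h2
  linarith

/-- The compound Poisson part vanishes with probability at least `exp (-ν(ℝ)) ≥ 1 - ν(ℝ)`. On that
event only `μ` contributes; the complement is simply charged to the bound. -/
theorem real_Ici_conv_compoundPoisson_le (μ ν : Measure ℝ) [IsProbabilityMeasure μ]
    [IsFiniteMeasure ν] (z : ℝ) :
    (compoundPoisson ν ∗ μ).real (Ici z) ≤ ν.real univ + μ.real (Ici z) := by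
  set κ := compoundPoisson ν with hκ
  have h0 : Real.exp (-ν.real univ) ≤ κ.real {0} := by
    have h := smul_dirac_le_compoundPoisson ν {0}
    have h' := ENNReal.toReal_mono (measure_ne_top _ _) h
    simpa [measureReal_def, Measure.smul_apply, ENNReal.toReal_ofReal (Real.exp_pos _).le] using h'
  have h1 : κ.real {0}ᶜ ≤ ν.real univ := by
    rw [probReal_compl_eq_one_sub (measurableSet_singleton _)]
    linarith [Real.add_one_le_exp (-ν.real univ)]
  have h2 : (κ ∗ μ) (Ici z) ≤ μ (Ici z) + κ {0}ᶜ := by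
    rw [conv_apply_eq_lintegral κ μ measurableSet_Ici]
    calc ∫⁻ x, μ ((fun w => x + w) ⁻¹' Ici z) ∂κ
        ≤ ∫⁻ x, (μ (Ici z) + ({0}ᶜ : Set ℝ).indicator 1 x) ∂κ := by
          refine lintegral_mono fun x => ?_
          by_cases hx : x = 0
          · simp [hx]
          · simpa [hx] using prob_le_one.trans le_add_self
      _ = _ := by
          rw [lintegral_add_left measurable_const, lintegral_const, measure_univ, mul_one,
            lintegral_indicator_one (measurableSet_singleton _).compl]
  have h3 := ENNReal.toReal_mono (by finiteness) h2
  rw [ENNReal.toReal_add (by finiteness) (by finiteness)] at h3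
  simp only [measureReal_def] at *
  linarith

/-! ### Exponential moment bounds -/

theorem real_Ici_le_exp_mul_integral (μ : Measure ℝ) [IsFiniteMeasure μ] {s : ℝ} (hs : 0 ≤ s)
    (hint : Integrable (fun x => Real.exp (s * x)) μ) (z : ℝ) :
    μ.real (Ici z) ≤ Real.exp (-(s * z)) * ∫ x, Real.exp (s * x) ∂μ := by
  have h := ProbabilityTheory.measure_ge_le_exp_mul_mgf (X := id) (μ := μ) z hs (by simpa using hint)
  simpa [ProbabilityTheory.mgf, Ici_def] using h

/-- The Paley–Zygmund inequality for `exp (s X)`. -/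
theorem paley_zygmund_exp (μ : Measure ℝ) [IsProbabilityMeasure μ] {s a θ : ℝ} (hs : 0 < s)
    (hint : Integrable (fun x => Real.exp (s * x)) μ)
    (hint2 : Integrable (fun x => Real.exp (2 * s * x)) μ) (hθ : θ ≤ 1)
    (ha : Real.exp (s * a) ≤ θ * ∫ x, Real.exp (s * x) ∂μ) :
    (1 - θ) ^ 2 * (∫ x, Real.exp (s * x) ∂μ) ^ 2 / (∫ x, Real.exp (2 * s * x) ∂μ) ≤
      μ.real (Ici a) := by
  set m := ∫ x, Real.exp (s * x) ∂μ with hm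
  set M := ∫ x, Real.exp (2 * s * x) ∂μ with hM
  have hMpos : 0 < M := integral_exp_pos hint2
  have hm0 : 0 ≤ m := integral_nonneg fun x => (Real.exp_pos _).le
  set q := ∫ x in Ici a, Real.exp (s * x) ∂μ with hq
  have hsplit : q + ∫ x in (Ici a)ᶜ, Real.exp (s * x) ∂μ = m :=
    integral_add_compl measurableSet_Ici hint
  -- Below `a` the integrand is at most `exp (s a) ≤ θ m`, so at least `(1 - θ) m` of the mean comes
  -- from `Ici a`.
  have hlow : ∫ x in (Ici a)ᶜ, Real.exp (s * x) ∂μ ≤ θ * m := by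
    calc ∫ x in (Ici a)ᶜ, Real.exp (s * x) ∂μ ≤ ∫ x in (Ici a)ᶜ, Real.exp (s * a) ∂μ := by
          refine setIntegral_mono_on hint.integrableOn (integrable_const _)
            measurableSet_Ici.compl fun x hx => ?_
          simp only [mem_compl_iff, mem_Ici, not_le] at hx
          gcongr
      _ = μ.real (Ici a)ᶜ * Real.exp (s * a) := by simp
      _ ≤ 1 * Real.exp (s * a) := by gcongr; exact measureReal_le_one
      _ ≤ θ * m := by linarith
  have hq1 : (1 - θ) * m ≤ q := by linarith
  -- Cauchy–Schwarz for `exp (s x)` and the indicator of `Ici a`, as nonnegativity of a quadratic in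
  -- `l`; it is used at the minimiser `l = q / M`.
  have hquad : ∀ l : ℝ, 0 ≤ l ^ 2 * M - 2 * l * q + μ.real (Ici a) := by
    intro l
    have hA : Integrable ((Ici a).indicator fun x => 2 * l * Real.exp (s * x)) μ :=
      (hint.const_mul _).indicator measurableSet_Ici
    have hB : Integrable ((Ici a).indicator fun _ => (1 : ℝ)) μ :=
      (integrable_const _).indicator measurableSet_Ici
    have h : 0 ≤ ∫ x, (l ^ 2 * Real.exp (2 * s * x) -
        (Ici a).indicator (fun x => 2 * l * Real.exp (s * x)) x +
        (Ici a).indicator (fun _ => (1 : ℝ)) x) ∂μ := by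
      refine integral_nonneg fun x => ?_
      have hx2 : Real.exp (2 * s * x) = Real.exp (s * x) ^ 2 := by
        rw [← Real.exp_nat_mul]; congr 1; push_cast; ring
      by_cases hx : x ∈ Ici a
      · simp only [Pi.zero_apply, indicator_of_mem hx, hx2]
        nlinarith [sq_nonneg (l * Real.exp (s * x) - 1)]
      · simp only [Pi.zero_apply, indicator_of_notMem hx, hx2, sub_zero, add_zero]
        positivity
    have hC : Integrable (fun x => l ^ 2 * Real.exp (2 * s * x) -
        (Ici a).indicator (fun x => 2 * l * Real.exp (s * x)) x) μ := (hint2.const_mul _).sub hA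
    rw [integral_add hC hB, integral_sub (hint2.const_mul _) hA,
      integral_const_mul, integral_indicator measurableSet_Ici, integral_const_mul,
      integral_indicator measurableSet_Ici] at h
    simpa using h
  have hfin := hquad (q / M)
  have : (q / M) ^ 2 * M - 2 * (q / M) * q = -(q ^ 2 / M) := by field_simp; ring
  have hsq : ((1 - θ) * m) ^ 2 ≤ q ^ 2 :=
    pow_le_pow_left₀ (mul_nonneg (by linarith) hm0) hq1 2
  rw [← mul_pow]
  calc ((1 - θ) * m) ^ 2 / M ≤ q ^ 2 / M := by gcongr
    _ ≤ _ := by linarith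

/-! ### The symmetric stable Lévy measure -/

instance isNegInvariant_symmetricStableLevyMeasure (α : ℝ) :
    (symmetricStableLevyMeasure α).IsNegInvariant := by
  constructor
  ext s hs
  rw [Measure.neg, Measure.map_apply measurable_neg hs, symmetricStableLevyMeasure,
    withDensity_apply _ (measurable_neg hs), withDensity_apply _ hs,
    ← lintegral_indicator (measurable_neg hs), ← lintegral_indicator hs,
    ← lintegral_neg_eq_self]
  refine lintegral_congr fun x => ?_
  by_cases hx : x ∈ s <;> simp [indicator, hx]

theorem symmetricStableLevyMeasure_singleton (α x : ℝ) : symmetricStableLevyMeasure α {x} = 0 :=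
  withDensity_absolutelyContinuous _ _ (measure_singleton x)

theorem isNegInvariant_restrict_abs_preimage (ν : Measure ℝ) [ν.IsNegInvariant] (S : Set ℝ) :
    (ν.restrict (abs ⁻¹' S)).IsNegInvariant := by
  constructor
  ext s hs
  rw [Measure.neg, Measure.map_apply measurable_neg hs, Measure.restrict_apply (measurable_neg hs),
    Measure.restrict_apply hs, ← Measure.measure_preimage_neg ν (s ∩ abs ⁻¹' S)]
  congr 1
  ext x
  simp

theorem restrict_symmetricStableLevyMeasure (α : ℝ) {S : Set ℝ} (hS : MeasurableSet S) :
    (symmetricStableLevyMeasure α).restrict S =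
      (volume.restrict S).withDensity fun x => ENNReal.ofReal (|x| ^ (-α - 1)) :=
  restrict_withDensity hS _

theorem integrableOn_symmetricStableLevyMeasure_iff (α : ℝ) {S : Set ℝ} (hS : MeasurableSet S)
    (hpos : S ⊆ Ioi 0) (f : ℝ → ℝ) :
    IntegrableOn f S (symmetricStableLevyMeasure α) ↔
      IntegrableOn (fun x => x ^ (-α - 1) * f x) S := by
  rw [IntegrableOn, restrict_symmetricStableLevyMeasure α hS,
    integrable_withDensity_iff_integrable_smul' (by fun_prop) (ae_of_all _ fun x => by simp),
    ← IntegrableOn]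
  refine integrableOn_congr_fun (fun x hx => ?_) hS
  have h0 : 0 < x := hpos hx
  simp only [abs_of_pos h0, smul_eq_mul]
  rw [ENNReal.toReal_ofReal (by positivity)]

theorem setIntegral_symmetricStableLevyMeasure (α : ℝ) {S : Set ℝ} (hS : MeasurableSet S)
    (hpos : S ⊆ Ioi 0) (f : ℝ → ℝ) :
    ∫ x in S, f x ∂(symmetricStableLevyMeasure α) = ∫ x in S, x ^ (-α - 1) * f x := by
  rw [restrict_symmetricStableLevyMeasure α hS,
    integral_withDensity_eq_integral_toReal_smul (by fun_prop) (ae_of_all _ fun x => by simp)]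
  refine setIntegral_congr_fun hS fun x hx => ?_
  have h0 : 0 < x := hpos hx
  simp only [abs_of_pos h0, smul_eq_mul]
  rw [ENNReal.toReal_ofReal (by positivity)]

theorem abs_preimage_eq_union_neg {S : Set ℝ} (hpos : S ⊆ Ioi 0) :
    abs ⁻¹' S = S ∪ Neg.neg ⁻¹' S := by
  ext x
  simp only [mem_preimage, mem_union]
  rcases lt_trichotomy x 0 with h | h | h
  · rw [abs_of_neg h]
    exact ⟨Or.inr, fun hx => hx.resolve_left fun h' => absurd (hpos h') (not_lt.2 h.le)⟩
  · simp [h]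
  · rw [abs_of_pos h]
    refine ⟨Or.inl, fun hx => hx.resolve_right fun h' => ?_⟩
    have := hpos h'
    simp only [mem_Ioi] at this
    linarith

theorem integrableOn_abs_preimage {ν : Measure ℝ} [ν.IsNegInvariant] {S : Set ℝ}
    (hpos : S ⊆ Ioi 0) {f : ℝ → ℝ} (hf : ∀ x, f (-x) = f x) (h : IntegrableOn f S ν) :
    IntegrableOn f (abs ⁻¹' S) ν := by
  rw [abs_preimage_eq_union_neg hpos]
  refine h.union ?_
  have := h.comp_neg
  simp only [hf] at this
  simpa using this

theorem setIntegral_abs_preimage {ν : Measure ℝ} [ν.IsNegInvariant] {S : Set ℝ}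
    (hS : MeasurableSet S) (hpos : S ⊆ Ioi 0) {f : ℝ → ℝ} (hf : ∀ x, f (-x) = f x)
    (h : IntegrableOn f S ν) :
    ∫ x in abs ⁻¹' S, f x ∂ν = 2 * ∫ x in S, f x ∂ν := by
  have hd : Disjoint S (Neg.neg ⁻¹' S) := by
    rw [Set.disjoint_left]
    intro x hx hx'
    have h1 : 0 < x := hpos hx
    have h2 : 0 < -x := hpos hx'
    linarith
  have hneg : ∫ x in Neg.neg ⁻¹' S, f x ∂ν = ∫ x in S, f x ∂ν := by
    have := (Measure.measurePreserving_neg ν).setIntegral_preimage_emb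
      (MeasurableEquiv.neg ℝ).measurableEmbedding f S
    simpa [hf] using this
  have hint := integrableOn_abs_preimage hpos hf h
  rw [abs_preimage_eq_union_neg hpos] at hint ⊢
  rw [setIntegral_union hd (measurable_neg hS) h hint.right_of_union, hneg]
  ring

section Moments

variable {α : ℝ}

theorem Ioc_subset_Ioi_zero {δ R : ℝ} (hδ : 0 ≤ δ) : Ioc δ R ⊆ Ioi 0 :=
  fun _ hx => lt_of_le_of_lt hδ hx.1

theorem Ioi_subset_Ioi_zero {R : ℝ} (hR : 0 ≤ R) : Ioi R ⊆ Ioi (0 : ℝ) :=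
  fun _ hx => lt_of_le_of_lt hR hx

theorem integrableOn_pow_Ioc (p : ℕ) (hp : α < p) (R : ℝ) :
    IntegrableOn (fun x => |x| ^ p) (Ioc 0 R) (symmetricStableLevyMeasure α) := by
  rw [integrableOn_symmetricStableLevyMeasure_iff α measurableSet_Ioc (Ioc_subset_Ioi_zero le_rfl)]
  rcases le_total R 0 with h | h
  · simp [Ioc_eq_empty_of_le h]
  have h1 := (intervalIntegral.intervalIntegrable_rpow' (a := 0) (b := R) (r := p - α - 1)
    (by linarith)).1
  refine h1.congr_fun (fun x hx => ?_) measurableSet_Ioc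
  simp only
  rw [abs_of_pos hx.1, ← Real.rpow_natCast, ← Real.rpow_add hx.1]
  congr 1
  ring

theorem setIntegral_pow_Ioc (p : ℕ) (hp : α < p) {δ R : ℝ} (hδ : 0 ≤ δ) (hR : δ ≤ R) :
    ∫ x in Ioc δ R, |x| ^ p ∂(symmetricStableLevyMeasure α) =
      (R ^ (p - α) - δ ^ (p - α)) / (p - α) := by
  rw [setIntegral_symmetricStableLevyMeasure α measurableSet_Ioc (Ioc_subset_Ioi_zero hδ)]
  have h1 := integral_rpow (a := δ) (b := R) (r := p - α - 1) (Or.inl (by linarith))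
  rw [intervalIntegral.integral_of_le hR, sub_add_cancel] at h1
  rw [← h1]
  refine setIntegral_congr_fun measurableSet_Ioc fun x hx => ?_
  have hx0 : 0 < x := Ioc_subset_Ioi_zero hδ hx
  rw [abs_of_pos hx0, ← Real.rpow_natCast, ← Real.rpow_add hx0]
  congr 1
  ring

theorem integrableOn_abs_Ioi (hα : 1 < α) {R : ℝ} (hR : 0 < R) :
    IntegrableOn (fun x => |x|) (Ioi R) (symmetricStableLevyMeasure α) := by
  rw [integrableOn_symmetricStableLevyMeasure_iff α measurableSet_Ioi (Ioi_subset_Ioi_zero hR.le)]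
  have h1 := integrableOn_Ioi_rpow_of_lt (a := -α) (by linarith) hR
  refine h1.congr_fun (fun x hx => ?_) measurableSet_Ioi
  have hx0 : 0 < x := Ioi_subset_Ioi_zero hR.le hx
  simp only
  rw [abs_of_pos hx0, ← Real.rpow_add_one hx0.ne']
  congr 1
  ring

theorem symmetricStableLevyMeasure_Ioi (hα : 0 < α) {R : ℝ} (hR : 0 < R) :
    symmetricStableLevyMeasure α (Ioi R) = ENNReal.ofReal (R ^ (-α) / α) := by
  rw [symmetricStableLevyMeasure, withDensity_apply _ measurableSet_Ioi]
  have h1 := integral_Ioi_rpow_of_lt (a := -α - 1) (by linarith) hR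
  have h2 := integrableOn_Ioi_rpow_of_lt (a := -α - 1) (by linarith) hR
  have h3 := ofReal_integral_eq_lintegral_ofReal h2
    ((ae_restrict_iff' measurableSet_Ioi).2 (ae_of_all _ fun x hx =>
      Real.rpow_nonneg (hR.le.trans (le_of_lt hx)) _))
  rw [h1] at h3
  rw [setLIntegral_congr_fun (g := fun x => ENNReal.ofReal (x ^ (-α - 1))) measurableSet_Ioi
    fun x hx => by simp only [abs_of_pos (hR.trans hx)], ← h3]
  congr 1
  rw [sub_add_cancel, neg_div_neg_eq]

theorem symmetricStableLevyMeasure_abs_Ioi (hα : 0 < α) {R : ℝ} (hR : 0 < R) :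
    symmetricStableLevyMeasure α (abs ⁻¹' Ioi R) = ENNReal.ofReal (2 * (R ^ (-α) / α)) := by
  have hpos := Ioi_subset_Ioi_zero hR.le
  have hd : Disjoint (Ioi R) (Neg.neg ⁻¹' Ioi R) := by
    rw [Set.disjoint_left]
    intro x hx hx'
    have h1 : 0 < x := hpos hx
    have h2 : 0 < -x := hpos hx'
    linarith
  rw [abs_preimage_eq_union_neg hpos, measure_union hd (measurable_neg measurableSet_Ioi),
    Measure.measure_preimage_neg, symmetricStableLevyMeasure_Ioi hα hR,
    ← ENNReal.ofReal_add (by positivity) (by positivity), two_mul]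

theorem isFiniteMeasure_restrict_levy (hα : 0 < α) {R : ℝ} (hR : 0 < R) {S : Set ℝ}
    (hS : S ⊆ abs ⁻¹' Ioi R) : IsFiniteMeasure ((symmetricStableLevyMeasure α).restrict S) := by
  constructor
  rw [Measure.restrict_apply_univ]
  refine (measure_mono hS).trans_lt ?_
  rw [symmetricStableLevyMeasure_abs_Ioi hα hR]
  exact ENNReal.ofReal_lt_top

end Moments

/-! ### Weak approximation by compound Poisson laws -/

/-- The quadratic bound serves near `0`, where `α < 2` makes it integrable; the linear bound serves
at infinity, where `α > 1` does. -/
theorem norm_exp_mul_I_sub_one_sub_le_sq (u : ℝ) :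
    ‖Complex.exp (u * Complex.I) - 1 - u * Complex.I‖ ≤ 3 * u ^ 2 ∧
      ‖Complex.exp (u * Complex.I) - 1 - u * Complex.I‖ ≤ 3 * |u| := by
  have hn : ‖(u : ℂ) * Complex.I‖ = |u| := by simp
  rcases le_total |u| 1 with h | h
  · have h1 := Complex.norm_exp_sub_one_sub_id_le (x := u * Complex.I) (by rwa [hn])
    rw [hn, sq_abs] at h1
    have h2 : u ^ 2 ≤ |u| := by rw [← sq_abs]; nlinarith [abs_nonneg u]
    constructor <;> linarith [sq_nonneg u]
  · have h1 : ‖Complex.exp (u * Complex.I) - 1 - u * Complex.I‖ ≤ 1 + 1 + |u| := by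
      refine (norm_sub_le _ _).trans (add_le_add ((norm_sub_le _ _).trans ?_) hn.le)
      rw [Complex.norm_exp_ofReal_mul_I, norm_one]
    have h2 : |u| ≤ u ^ 2 := by rw [← sq_abs]; nlinarith
    constructor <;> linarith

theorem integrable_levyKhintchine {α : ℝ} (hα : α ∈ Ioo (1 : ℝ) 2) (t : ℝ) :
    Integrable (fun x : ℝ => Complex.exp (t * x * Complex.I) - 1 - t * x * Complex.I)
      (symmetricStableLevyMeasure α) := by
  have hA : IntegrableOn (fun x => |x| ^ 2) (abs ⁻¹' Ioc 0 1) (symmetricStableLevyMeasure α) :=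
    integrableOn_abs_preimage (Ioc_subset_Ioi_zero le_rfl) (by simp)
      (integrableOn_pow_Ioc 2 (by simpa using hα.2) 1)
  have hB : IntegrableOn (fun x => |x|) (abs ⁻¹' Ioi 1) (symmetricStableLevyMeasure α) :=
    integrableOn_abs_preimage (Ioi_subset_Ioi_zero zero_le_one) (by simp)
      (integrableOn_abs_Ioi hα.1 one_pos)
  have hmeas : Continuous (fun x : ℝ => Complex.exp (t * x * Complex.I) - 1 - t * x * Complex.I) :=
    by fun_prop
  have hA' : IntegrableOn (fun x : ℝ => Complex.exp (t * x * Complex.I) - 1 - t * x * Complex.I)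
      (abs ⁻¹' Ioc 0 1) (symmetricStableLevyMeasure α) := by
    refine Integrable.mono' (hA.const_mul (3 * t ^ 2)) hmeas.aestronglyMeasurable
      (ae_of_all _ fun x => ?_)
    have h := (norm_exp_mul_I_sub_one_sub_le_sq (t * x)).1
    rw [mul_pow, ← mul_assoc] at h
    simpa using h
  have hB' : IntegrableOn (fun x : ℝ => Complex.exp (t * x * Complex.I) - 1 - t * x * Complex.I)
      (abs ⁻¹' Ioi 1) (symmetricStableLevyMeasure α) := by
    refine Integrable.mono' (hB.const_mul (3 * |t|)) hmeas.aestronglyMeasurable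
      (ae_of_all _ fun x => ?_)
    have h := (norm_exp_mul_I_sub_one_sub_le_sq (t * x)).2
    rw [abs_mul, ← mul_assoc] at h
    simpa using h
  have hC : IntegrableOn (fun x : ℝ => Complex.exp (t * x * Complex.I) - 1 - t * x * Complex.I)
      {0} (symmetricStableLevyMeasure α) := by
    rw [IntegrableOn, Measure.restrict_eq_zero.2 (symmetricStableLevyMeasure_singleton α 0)]
    exact integrable_zero_measure
  rw [← integrableOn_univ]
  refine ((hA'.union hB').union hC).mono_set fun x _ => ?_
  simp only [mem_union, mem_preimage, mem_Ioc, mem_Ioi, mem_singleton_iff, abs_pos]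
  by_cases hx : x = 0
  · exact Or.inr hx
  · exact Or.inl ((le_or_gt |x| 1).imp (fun h => ⟨hx, h⟩) id)

/-- The Lévy measure of the jumps of size larger than `δ`. -/
noncomputable abbrev levyTail (α δ : ℝ) : Measure ℝ :=
  (symmetricStableLevyMeasure α).restrict (abs ⁻¹' Ioi δ)

/-- The compensator is odd and integrable away from `0`, so its integral against a symmetric measure
vanishes. -/
theorem integral_levyTail_compensate {α δ : ℝ} (hα : α ∈ Ioo (1 : ℝ) 2) (hδ : 0 < δ) (t : ℝ) :
    ∫ x, (Complex.exp (t * x * Complex.I) - 1) ∂(levyTail α δ) =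
      ∫ x in abs ⁻¹' Ioi δ, (Complex.exp (t * x * Complex.I) - 1 - t * x * Complex.I)
        ∂(symmetricStableLevyMeasure α) := by
  have hfin := isFiniteMeasure_restrict_levy (α := α) (by linarith [hα.1]) hδ
    (Subset.refl (abs ⁻¹' Ioi δ))
  have hsym := isNegInvariant_restrict_abs_preimage (symmetricStableLevyMeasure α) (Ioi δ)
  have h1 : Integrable (fun x : ℝ => Complex.exp (t * x * Complex.I) - 1) (levyTail α δ) := by
    refine (Integrable.of_bound (by fun_prop) 1 (ae_of_all _ fun x => ?_)).sub (integrable_const _)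
    rw [← Complex.ofReal_mul, Complex.norm_exp_ofReal_mul_I]
  have h2 : Integrable (fun x : ℝ => (t * x * Complex.I : ℂ)) (levyTail α δ) := by
    refine Integrable.mono' ((integrableOn_abs_preimage (Ioi_subset_Ioi_zero hδ.le) (by simp)
      (integrableOn_abs_Ioi hα.1 hδ)).const_mul |t|) (by fun_prop) (ae_of_all _ fun x => ?_)
    simp
  have h3 : ∫ x : ℝ, (t * x * Complex.I : ℂ) ∂(levyTail α δ) = 0 := by
    have h := integral_neg_eq_self (fun x : ℝ => (t * x * Complex.I : ℂ)) (levyTail α δ)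
    simp only [Complex.ofReal_neg, mul_neg, neg_mul, integral_neg] at h
    exact self_eq_neg.1 h.symm
  rw [integral_sub h1 h2, h3, sub_zero]

theorem tendsto_charFun_compoundPoisson_levyTail {α : ℝ} (hα : α ∈ Ioo (1 : ℝ) 2) (t : ℝ) :
    Tendsto (fun n : ℕ => charFun (compoundPoisson (levyTail α (1 / (n + 1)))) t) atTop
      (𝓝 (Complex.exp (∫ x : ℝ, (Complex.exp (t * x * Complex.I) - 1 - t * x * Complex.I)
        ∂(symmetricStableLevyMeasure α)))) := by
  have hpos : ∀ n : ℕ, (0 : ℝ) < 1 / (n + 1) := fun n => Nat.one_div_pos_of_nat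
  have heq : ∀ n : ℕ, charFun (compoundPoisson (levyTail α (1 / (n + 1)))) t =
      Complex.exp (∫ x in abs ⁻¹' Ioi (1 / ((n : ℝ) + 1)),
        (Complex.exp (t * x * Complex.I) - 1 - t * x * Complex.I)
        ∂(symmetricStableLevyMeasure α)) := by
    intro n
    have hfin := isFiniteMeasure_restrict_levy (α := α) (by linarith [hα.1]) (hpos n)
      (Subset.refl (abs ⁻¹' Ioi (1 / ((n : ℝ) + 1))))
    rw [charFun_compoundPoisson, integral_levyTail_compensate hα (hpos n)]
  simp_rw [heq]
  refine (Complex.continuous_exp.tendsto _).comp ?_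
  have hU : ⋃ n : ℕ, abs ⁻¹' Ioi (1 / ((n : ℝ) + 1)) = ({0}ᶜ : Set ℝ) := by
    ext x
    simp only [mem_iUnion, mem_preimage, mem_Ioi, mem_compl_iff, mem_singleton_iff]
    refine ⟨fun ⟨n, hn⟩ h => ?_, fun h => exists_nat_one_div_lt (abs_pos.2 h)⟩
    rw [h, abs_zero] at hn
    exact absurd hn (not_lt.2 (hpos n).le)
  have hlim := tendsto_setIntegral_of_monotone (μ := symmetricStableLevyMeasure α)
    (s := fun n : ℕ => abs ⁻¹' Ioi (1 / ((n : ℝ) + 1)))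
    (f := fun x : ℝ => Complex.exp (t * x * Complex.I) - 1 - t * x * Complex.I)
    (fun n => measurable_abs measurableSet_Ioi)
    (fun m n hmn => preimage_mono (Ioi_subset_Ioi (Nat.one_div_le_one_div hmn)))
    (integrable_levyKhintchine hα t).integrableOn
  rw [hU, setIntegral_congr_set (t := univ) ?_, setIntegral_univ] at hlim
  · exact hlim
  · rw [ae_eq_univ, compl_compl]
    exact symmetricStableLevyMeasure_singleton α 0

/-! ### Exponential moments of small jumps -/

theorem hasSum_cosh_sub (u : ℝ) :
    HasSum (fun n : ℕ => u ^ (2 * (n + 2)) / (2 * (n + 2))!) (Real.cosh u - 1 - u ^ 2 / 2) := by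
  have h := (hasSum_nat_add_iff' 2).2 (Real.hasSum_cosh u)
  simpa [Finset.sum_range_succ, sub_sub] using h

theorem cosh_sub_nonneg (u : ℝ) : 0 ≤ Real.cosh u - 1 - u ^ 2 / 2 :=
  (hasSum_cosh_sub u).nonneg fun n => by
    rw [pow_mul]
    positivity

/-- The power series of the remainder starts in degree four, so each term shrinks by at least `r ^
4`. -/
theorem cosh_mul_sub_le {r : ℝ} (hr : |r| ≤ 1) (u : ℝ) :
    Real.cosh (r * u) - 1 - (r * u) ^ 2 / 2 ≤ r ^ 4 * (Real.cosh u - 1 - u ^ 2 / 2) := by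
  refine hasSum_le (fun n => ?_) (hasSum_cosh_sub (r * u)) ((hasSum_cosh_sub u).mul_left _)
  have h1 : (r ^ 2) ^ n ≤ 1 := pow_le_one₀ (sq_nonneg r) ((sq_le_one_iff_abs_le_one r).2 hr)
  have h2 : 0 ≤ u ^ (2 * (n + 2)) / ((2 * (n + 2))! : ℝ) := by
    rw [pow_mul]
    positivity
  calc (r * u) ^ (2 * (n + 2)) / ((2 * (n + 2))! : ℝ)
      = (r ^ 2) ^ n * (r ^ 4 * (u ^ (2 * (n + 2)) / ((2 * (n + 2))! : ℝ))) := by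
        rw [mul_pow, ← pow_mul]; ring
    _ ≤ 1 * (r ^ 4 * (u ^ (2 * (n + 2)) / ((2 * (n + 2))! : ℝ))) := by
        refine mul_le_mul_of_nonneg_right h1 (mul_nonneg (by positivity) h2)
    _ = _ := one_mul _

/-- The Lévy measure of the jumps of size in `(δ, R]`. -/
noncomputable abbrev levyAnnulus (α δ R : ℝ) : Measure ℝ :=
  (symmetricStableLevyMeasure α).restrict (abs ⁻¹' Ioc δ R)

section Annulus

variable {α δ R : ℝ}

theorem isFiniteMeasure_levyAnnulus (hα : 0 < α) (hδ : 0 < δ) :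
    IsFiniteMeasure (levyAnnulus α δ R) :=
  isFiniteMeasure_restrict_levy hα hδ (preimage_mono Ioc_subset_Ioi_self)

theorem integrable_exp_levyAnnulus (hα : 0 < α) (hδ : 0 < δ) (s : ℝ) :
    Integrable (fun x => Real.exp (s * x)) (levyAnnulus α δ R) := by
  have := isFiniteMeasure_levyAnnulus (R := R) hα hδ
  refine Integrable.of_bound (by fun_prop) (Real.exp (|s| * R))
    ((ae_restrict_iff' (measurable_abs measurableSet_Ioc)).2 (ae_of_all _ fun x hx => ?_))
  rw [Real.norm_eq_abs, Real.abs_exp]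
  refine Real.exp_le_exp.2 ((le_abs_self _).trans ?_)
  rw [abs_mul]
  exact mul_le_mul_of_nonneg_left hx.2 (abs_nonneg s)

theorem integrable_cosh_levyAnnulus (hα : 0 < α) (hδ : 0 < δ) (s : ℝ) :
    Integrable (fun x => Real.cosh (s * x) - 1) (levyAnnulus α δ R) := by
  have := isFiniteMeasure_levyAnnulus (R := R) hα hδ
  have h1 := integrable_exp_levyAnnulus (R := R) hα hδ s
  have h2 := integrable_exp_levyAnnulus (R := R) hα hδ (-s)
  refine (((h1.add h2).div_const 2).sub (integrable_const 1)).congr (ae_of_all _ fun x => ?_)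
  simp [Real.cosh_eq]

theorem integral_exp_sub_one_levyAnnulus (hα : 0 < α) (hδ : 0 < δ) (s : ℝ) :
    ∫ x, (Real.exp (s * x) - 1) ∂(levyAnnulus α δ R) =
      ∫ x, (Real.cosh (s * x) - 1) ∂(levyAnnulus α δ R) := by
  have := isFiniteMeasure_levyAnnulus (R := R) hα hδ
  have hsym := isNegInvariant_restrict_abs_preimage (symmetricStableLevyMeasure α) (Ioc δ R)
  have h1 := (integrable_exp_levyAnnulus (R := R) hα hδ s).sub (integrable_const 1)
  have h2 := integral_neg_eq_self (fun x => Real.cosh (s * x) - 1) (levyAnnulus α δ R)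
  have h3 := integral_neg_eq_self (fun x => Real.exp (s * x) - 1) (levyAnnulus α δ R)
  have h4 := integral_add h1 h1.comp_neg
  simp only [Pi.sub_apply] at h4
  rw [h3] at h4
  have h5 : ∀ x : ℝ, Real.exp (s * x) - 1 + (Real.exp (s * -x) - 1) =
      2 * (Real.cosh (s * x) - 1) := by
    intro x
    rw [Real.cosh_eq, mul_neg]
    ring
  simp_rw [h5] at h4
  rw [integral_const_mul] at h4
  linarith

theorem integrable_pow_levyAnnulus (p : ℕ) (hp : α < p) (hδ : 0 < δ) :
    Integrable (fun x => |x| ^ p) (levyAnnulus α δ R) :=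
  integrableOn_abs_preimage (Ioc_subset_Ioi_zero hδ.le) (by simp)
    ((integrableOn_pow_Ioc p hp R).mono_set (Ioc_subset_Ioc_left hδ.le))

theorem integral_pow_levyAnnulus (p : ℕ) (hp : α < p) (hδ : 0 < δ) (hR : δ ≤ R) :
    ∫ x, |x| ^ p ∂(levyAnnulus α δ R) = 2 * ((R ^ (p - α) - δ ^ (p - α)) / (p - α)) := by
  rw [setIntegral_abs_preimage measurableSet_Ioc (Ioc_subset_Ioi_zero hδ.le) (by simp)
    ((integrableOn_pow_Ioc p hp R).mono_set (Ioc_subset_Ioc_left hδ.le)),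
    setIntegral_pow_Ioc p hp hδ.le hR]

theorem le_integral_exp_sub_one_levyAnnulus (hα : α ∈ Ioo (1 : ℝ) 2) (hδ : 0 < δ) (hR : δ ≤ R)
    (s : ℝ) :
    s ^ 2 * ((R ^ (2 - α) - δ ^ (2 - α)) / (2 - α)) ≤
      ∫ x, (Real.exp (s * x) - 1) ∂(levyAnnulus α δ R) := by
  have hα0 : 0 < α := by linarith [hα.1]
  have hp : α < (2 : ℕ) := by simpa using hα.2
  rw [integral_exp_sub_one_levyAnnulus hα0 hδ]
  have h1 := integral_pow_levyAnnulus 2 hp hδ hR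
  have h2 : ∫ x, s ^ 2 / 2 * |x| ^ 2 ∂(levyAnnulus α δ R) ≤
      ∫ x, (Real.cosh (s * x) - 1) ∂(levyAnnulus α δ R) := by
    refine integral_mono ((integrable_pow_levyAnnulus 2 hp hδ).const_mul _)
      (integrable_cosh_levyAnnulus hα0 hδ s) fun x => ?_
    have := cosh_sub_nonneg (s * x)
    simp only [sq_abs]
    nlinarith
  rw [integral_const_mul, h1] at h2
  push_cast at h2
  linarith

/-- By symmetry only `cosh (s x) - 1` matters. Its quadratic part gives the variance term, with the
factor `1/(2-α)`. The remainder is dominated by `(x/R)^4` times its value at `R`, and integrating a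
fourth power costs only `1/(4-α)`, which stays bounded as `α → 2`. -/
theorem integral_exp_sub_one_levyAnnulus_le (hα : α ∈ Ioo (1 : ℝ) 2) (hδ : 0 < δ) (hR : δ ≤ R)
    (s : ℝ) :
    ∫ x, (Real.exp (s * x) - 1) ∂(levyAnnulus α δ R) ≤
      s ^ 2 * (R ^ (2 - α) / (2 - α)) +
        2 * (Real.cosh (s * R) - 1 - (s * R) ^ 2 / 2) * R ^ (-α) / (4 - α) := by
  have hα0 : 0 < α := by linarith [hα.1]
  have hR0 : 0 < R := hδ.trans_le hR
  have hp : α < (2 : ℕ) := by simpa using hα.2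
  have hp' : α < (4 : ℕ) := by push_cast; linarith [hα.2]
  have hε : 0 < 2 - α := by linarith [hα.2]
  have hε' : 0 < 4 - α := by linarith [hα.2]
  rw [integral_exp_sub_one_levyAnnulus hα0 hδ]
  set g := Real.cosh (s * R) - 1 - (s * R) ^ 2 / 2 with hg
  have hg0 : 0 ≤ g := cosh_sub_nonneg _
  have h2 : ∫ x, (Real.cosh (s * x) - 1) ∂(levyAnnulus α δ R) ≤
      ∫ x, (s ^ 2 / 2 * |x| ^ 2 + g / R ^ 4 * |x| ^ 4) ∂(levyAnnulus α δ R) := by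
    refine integral_mono_ae (integrable_cosh_levyAnnulus hα0 hδ s)
      (((integrable_pow_levyAnnulus 2 hp hδ).const_mul _).add
        ((integrable_pow_levyAnnulus 4 hp' hδ).const_mul _))
      ((ae_restrict_iff' (measurable_abs measurableSet_Ioc)).2 (ae_of_all _ fun x hx => ?_))
    have hx : |x| ≤ R := hx.2
    have h := cosh_mul_sub_le (r := x / R)
      (by rw [abs_div, abs_of_pos hR0]; exact (div_le_one hR0).2 hx) (s * R)
    rw [← hg, show x / R * (s * R) = s * x by field_simp, div_pow] at h
    have h4 : |x| ^ 4 = x ^ 4 := by rw [show (4 : ℕ) = 2 * 2 by rfl, pow_mul, sq_abs, pow_mul]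
    simp only [sq_abs, h4]
    have h5 : g / R ^ 4 * x ^ 4 = x ^ 4 / R ^ 4 * g := by ring
    rw [h5]
    nlinarith
  refine h2.trans ?_
  rw [integral_add ((integrable_pow_levyAnnulus 2 hp hδ).const_mul _)
    ((integrable_pow_levyAnnulus 4 hp' hδ).const_mul _), integral_const_mul, integral_const_mul,
    integral_pow_levyAnnulus 2 hp hδ hR, integral_pow_levyAnnulus 4 hp' hδ hR]
  push_cast
  have h3 : R ^ (4 - α) = R ^ 4 * R ^ (-α) := by
    rw [← Real.rpow_natCast, ← Real.rpow_add hR0]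
    norm_num [sub_eq_add_neg]
  have h4 : 0 ≤ δ ^ (4 - α) := by positivity
  have h5 : 0 ≤ δ ^ (2 - α) := by positivity
  refine add_le_add ?_ ?_
  · calc s ^ 2 / 2 * (2 * ((R ^ (2 - α) - δ ^ (2 - α)) / (2 - α)))
        ≤ s ^ 2 / 2 * (2 * (R ^ (2 - α) / (2 - α))) := by gcongr; linarith
      _ = _ := by ring
  · calc g / R ^ 4 * (2 * ((R ^ (4 - α) - δ ^ (4 - α)) / (4 - α)))
        ≤ g / R ^ 4 * (2 * (R ^ (4 - α) / (4 - α))) := by gcongr; linarith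
      _ = _ := by rw [h3]; field_simp

end Annulus

/-! ### Passing to the limit -/

section Limit

variable {μ : Measure ℝ} [IsProbabilityMeasure μ] {κ : ℕ → Measure ℝ}
  [∀ n, IsProbabilityMeasure (κ n)]

theorem tendsto_probabilityMeasure_of_charFun
    (h : ∀ t, Tendsto (fun n => charFun (κ n) t) atTop (𝓝 (charFun μ t))) :
    Tendsto (β := ProbabilityMeasure ℝ) (fun n => ⟨κ n, inferInstance⟩) atTop
      (𝓝 (id (α := ProbabilityMeasure ℝ) ⟨μ, inferInstance⟩)) :=
  ProbabilityMeasure.tendsto_of_tendsto_charFun h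

theorem le_real_Ici_of_tendsto_charFun
    (h : ∀ t, Tendsto (fun n => charFun (κ n) t) atTop (𝓝 (charFun μ t))) {a l : ℝ} {b : ℕ → ℝ}
    (hb : ∀ᶠ n in atTop, b n ≤ (κ n).real (Ici a)) (hl : Tendsto b atTop (𝓝 l)) :
    l ≤ μ.real (Ici a) := by
  have h1 := ProbabilityMeasure.limsup_measure_closed_le_of_tendsto
    (tendsto_probabilityMeasure_of_charFun h) (isClosed_Ici (a := a))
  have h2 : ENNReal.ofReal l ≤ μ (Ici a) := by
    refine le_trans ?_ h1
    rw [← ((ENNReal.continuous_ofReal.tendsto l).comp hl).limsup_eq]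
    refine limsup_le_limsup (hb.mono fun n hn => ?_)
    simp only [Function.comp, ProbabilityMeasure.coe_mk]
    rw [← ofReal_measureReal]
    exact ENNReal.ofReal_le_ofReal hn
  exact (ENNReal.ofReal_le_iff_le_toReal (measure_ne_top _ _)).1 h2

/-- Portmanteau bounds limits on open sets from above, so the closed half-line is enlarged to `Ioi
z` with `z < a`. This is why the bound is required at every `z` and `B` must be continuous at `a`.
-/
theorem real_Ici_le_of_tendsto_charFun
    (h : ∀ t, Tendsto (fun n => charFun (κ n) t) atTop (𝓝 (charFun μ t))) {a : ℝ} {B : ℝ → ℝ}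
    (hB : ∀ᶠ n in atTop, ∀ z, (κ n).real (Ici z) ≤ B z) (hcont : ContinuousAt B a) :
    μ.real (Ici a) ≤ B a := by
  have key : ∀ z < a, μ.real (Ici a) ≤ B z := by
    intro z hz
    have h0 : 0 ≤ B z := by
      obtain ⟨n, hn⟩ := hB.exists
      exact measureReal_nonneg.trans (hn z)
    have h1 := ProbabilityMeasure.le_liminf_measure_open_of_tendsto
      (tendsto_probabilityMeasure_of_charFun h) (isOpen_Ioi (a := z))
    have h2 : μ (Ici a) ≤ ENNReal.ofReal (B z) := by
      refine (measure_mono (Ici_subset_Ioi.2 hz)).trans (h1.trans ?_)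
      rw [← liminf_const (f := (atTop : Filter ℕ)) (ENNReal.ofReal (B z))]
      refine liminf_le_liminf (hB.mono fun n hn => ?_)
      simp only [ProbabilityMeasure.coe_mk]
      refine (measure_mono Ioi_subset_Ici_self).trans ?_
      rw [← ofReal_measureReal]
      exact ENNReal.ofReal_le_ofReal (hn z)
    exact ENNReal.toReal_le_of_le_ofReal h0 h2
  exact ge_of_tendsto (hcont.tendsto.mono_left nhdsWithin_le_nhds : Tendsto B (𝓝[<] a) _)
    (eventually_mem_nhdsWithin.mono key)

end Limit

/-! ### Tail bounds for the approximating laws -/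

section Approx

variable {α δ R : ℝ}

theorem levyTail_eq_add (hδR : δ ≤ R) :
    levyTail α δ = levyTail α R + levyAnnulus α δ R := by
  have hd : Disjoint (Ioc δ R) (Ioi R) := disjoint_left.2 fun x hx hx' => not_lt.2 hx.2 hx'
  rw [levyTail, levyTail, levyAnnulus, add_comm, ← Measure.restrict_union (hd.preimage _)
    (measurable_abs measurableSet_Ioi), ← preimage_union, Ioc_union_Ioi_eq_Ioi hδR]

theorem real_univ_levyTail (hα : 0 < α) (hR : 0 < R) :
    (levyTail α R).real univ = 2 * (R ^ (-α) / α) := by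
  rw [measureReal_restrict_apply MeasurableSet.univ, univ_inter, measureReal_def,
    symmetricStableLevyMeasure_abs_Ioi hα hR, ENNReal.toReal_ofReal (by positivity)]

/-- One factor `1/2` is the Lévy-type inequality for the jumps beyond `R`; the other passes from
`|x| ≥ R` to one side. -/
theorem le_real_Ici_compoundPoisson_levyTail (hα : 0 < α) (hδ : 0 < δ) (hδR : δ ≤ R) :
    1 / 4 * (1 - Real.exp (-(2 * (R ^ (-α) / α)))) ≤
      (compoundPoisson (levyTail α δ)).real (Ici R) := by
  have hR : 0 < R := hδ.trans_le hδR
  have hf := isFiniteMeasure_restrict_levy (α := α) hα hδ (Subset.refl (abs ⁻¹' Ioi δ))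
  have hf1 := isFiniteMeasure_restrict_levy (α := α) hα hR (Subset.refl (abs ⁻¹' Ioi R))
  have hf2 := isFiniteMeasure_levyAnnulus (R := R) hα hδ
  have hs := isNegInvariant_restrict_abs_preimage (symmetricStableLevyMeasure α) (Ioi δ)
  have hs1 := isNegInvariant_restrict_abs_preimage (symmetricStableLevyMeasure α) (Ioi R)
  have hs2 := isNegInvariant_restrict_abs_preimage (symmetricStableLevyMeasure α) (Ioc δ R)
  have h1 := half_mul_one_sub_exp_le_conv (levyTail α R) (compoundPoisson (levyAnnulus α δ R))
    (y := R) ((ae_restrict_iff' (measurable_abs measurableSet_Ioi)).2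
      (ae_of_all _ fun x hx => le_of_lt hx))
  rw [← compoundPoisson_add, ← levyTail_eq_add hδR, real_le_abs_eq_two_mul _ hR,
    real_univ_levyTail hα hR] at h1
  linarith

theorem half_mul_real_Ici_levyAnnulus_le (hα : 0 < α) (hδ : 0 < δ) (hδR : δ ≤ R) (a : ℝ) :
    1 / 2 * (compoundPoisson (levyAnnulus α δ R)).real (Ici a) ≤
      (compoundPoisson (levyTail α δ)).real (Ici a) := by
  have hR : 0 < R := hδ.trans_le hδR
  have hf1 := isFiniteMeasure_restrict_levy (α := α) hα hR (Subset.refl (abs ⁻¹' Ioi R))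
  have hf2 := isFiniteMeasure_levyAnnulus (R := R) hα hδ
  have hs1 := isNegInvariant_restrict_abs_preimage (symmetricStableLevyMeasure α) (Ioi R)
  rw [levyTail_eq_add hδR, add_comm, compoundPoisson_add]
  exact half_mul_real_Ici_le_conv _ _ a

theorem paley_zygmund_levyAnnulus (hα : α ∈ Ioo (1 : ℝ) 2) (hδ : 0 < δ) (hδ1 : δ ≤ 1) {s a v : ℝ}
    (hs : 0 < s) (hv : v = s ^ 2 * ((1 - δ ^ (2 - α)) / (2 - α))) (hva : s * a ≤ v) :
    (1 - Real.exp (-(v - s * a))) ^ 2 * Real.exp (2 * v - (4 * s ^ 2 / (2 - α) +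
        (Real.cosh (2 * s) - 1 - (2 * s) ^ 2 / 2))) ≤
      (compoundPoisson (levyAnnulus α δ 1)).real (Ici a) := by
  have hα0 : 0 < α := by linarith [hα.1]
  have hf := isFiniteMeasure_levyAnnulus (R := 1) hα0 hδ
  have hi1 := integrable_exp_levyAnnulus (R := 1) hα0 hδ s
  have hi2 := integrable_exp_levyAnnulus (R := 1) hα0 hδ (2 * s)
  have hlow := le_integral_exp_sub_one_levyAnnulus hα hδ hδ1 s
  have hup := integral_exp_sub_one_levyAnnulus_le hα hδ hδ1 (2 * s)
  rw [Real.one_rpow, ← hv] at hlow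
  simp only [Real.one_rpow, mul_one] at hup
  have hg := cosh_sub_nonneg (2 * s)
  set g := Real.cosh (2 * s) - 1 - (2 * s) ^ 2 / 2
  have hg4 : 2 * g / (4 - α) ≤ g := by
    rw [div_le_iff₀ (by linarith [hα.2])]
    nlinarith [hα.2]
  have hup' : ∫ x, (Real.exp (2 * s * x) - 1) ∂(levyAnnulus α δ 1) ≤
      4 * s ^ 2 / (2 - α) + g := by
    refine hup.trans (add_le_add (le_of_eq ?_) hg4)
    ring
  have hpz := paley_zygmund_exp (compoundPoisson (levyAnnulus α δ 1)) (a := a)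
    -- With this `θ`, `exp (s a) = θ exp v`, and `exp v` is a lower bound for the first exponential
    -- moment.
    (θ := Real.exp (-(v - s * a))) hs (integrable_exp_compoundPoisson hi1)
    (integrable_exp_compoundPoisson hi2) (Real.exp_le_one_iff.2 (by linarith)) (by
      rw [integral_exp_compoundPoisson hi1, ← Real.exp_add]
      exact Real.exp_le_exp.2 (by linarith))
  rw [integral_exp_compoundPoisson hi1, integral_exp_compoundPoisson hi2, ← Real.exp_nat_mul,
    mul_div_assoc, ← Real.exp_sub] at hpz
  refine le_trans (mul_le_mul_of_nonneg_left (Real.exp_le_exp.2 ?_) (sq_nonneg _)) hpz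
  push_cast
  linarith

theorem real_Ici_compoundPoisson_levyTail_le (hα : α ∈ Ioo (1 : ℝ) 2) (hδ : 0 < δ) (hδR : δ ≤ R)
    {s : ℝ} (hs : 0 ≤ s) (z : ℝ) :
    (compoundPoisson (levyTail α δ)).real (Ici z) ≤ R ^ (-α) / α +
      Real.exp (-(s * z) + (s ^ 2 * (R ^ (2 - α) / (2 - α)) +
        2 * (Real.cosh (s * R) - 1 - (s * R) ^ 2 / 2) * R ^ (-α) / (4 - α))) := by
  have hα0 : 0 < α := by linarith [hα.1]
  have hR : 0 < R := hδ.trans_le hδR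
  set ν := symmetricStableLevyMeasure α with hν
  -- Large negative jumps can only lower `E exp (sX)` for `s ≥ 0`. Keeping them in the Chernoff part
  -- leaves just the one-sided mass `R^{-α}/α` to pay.
  set C : Set ℝ := Iio (-R) with hC
  have hsub : C ⊆ abs ⁻¹' Ioi δ := fun x hx => by
    have hx : x < -R := hx
    rw [mem_preimage, mem_Ioi, lt_abs]
    exact Or.inr (by linarith)
  have hf1 : IsFiniteMeasure (ν.restrict (Ioi R)) :=
    isFiniteMeasure_restrict_levy hα0 hR fun x hx => lt_of_lt_of_le hx (le_abs_self x)
  have hfC : IsFiniteMeasure (ν.restrict C) := isFiniteMeasure_restrict_levy hα0 hδ hsub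
  have hfA := isFiniteMeasure_levyAnnulus (R := R) hα0 hδ
  have hdec : levyTail α δ = ν.restrict (Ioi R) + (ν.restrict C + levyAnnulus α δ R) := by
    rw [levyTail_eq_add hδR, ← add_assoc]
    congr 1
    have hu : abs ⁻¹' Ioi R = Ioi R ∪ C := by
      ext x
      simp only [mem_preimage, mem_Ioi, mem_union, lt_abs, hC, mem_Iio, lt_neg]
    rw [levyTail, hu, Measure.restrict_union _ measurableSet_Iio]
    exact disjoint_left.2 fun x hx hx' => by
      have h1 : R < x := hx
      have h2 : x < -R := hx'
      linarith
  have hiA := integrable_exp_levyAnnulus (R := R) hα0 hδ s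
  have hiC : Integrable (fun x => Real.exp (s * x)) (ν.restrict C) := by
    refine Integrable.of_bound (by fun_prop) 1
      ((ae_restrict_iff' measurableSet_Iio).2 (ae_of_all _ fun x hx => ?_))
    rw [Real.norm_eq_abs, Real.abs_exp, Real.exp_le_one_iff]
    have hx : x < -R := hx
    exact mul_nonpos_of_nonneg_of_nonpos hs (by linarith)
  have hint : Integrable (fun x => Real.exp (s * x)) (ν.restrict C + levyAnnulus α δ R) :=
    hiC.add_measure hiA
  have hneg : ∫ x, (Real.exp (s * x) - 1) ∂(ν.restrict C) ≤ 0 := by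
    refine setIntegral_nonpos measurableSet_Iio fun x hx => ?_
    have hx : x < -R := hx
    have := Real.exp_le_one_iff.2 (mul_nonpos_of_nonneg_of_nonpos hs (show x ≤ 0 by linarith))
    linarith
  have hexp : ∫ x, (Real.exp (s * x) - 1) ∂(ν.restrict C + levyAnnulus α δ R) ≤
      s ^ 2 * (R ^ (2 - α) / (2 - α)) +
        2 * (Real.cosh (s * R) - 1 - (s * R) ^ 2 / 2) * R ^ (-α) / (4 - α) := by
    have hiC' : Integrable (fun x => Real.exp (s * x) - 1) (ν.restrict C) :=
      hiC.sub (integrable_const _)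
    have hiA' : Integrable (fun x => Real.exp (s * x) - 1) (levyAnnulus α δ R) :=
      hiA.sub (integrable_const _)
    rw [integral_add_measure hiC' hiA']
    linarith [integral_exp_sub_one_levyAnnulus_le hα hδ hδR s]
  have hmass : (ν.restrict (Ioi R)).real univ = R ^ (-α) / α := by
    rw [measureReal_restrict_apply MeasurableSet.univ, univ_inter, measureReal_def,
      symmetricStableLevyMeasure_Ioi hα0 hR, ENNReal.toReal_ofReal (by positivity)]
  rw [hdec, compoundPoisson_add]
  refine (real_Ici_conv_compoundPoisson_le _ _ z).trans (add_le_add hmass.le ?_)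
  refine (real_Ici_le_exp_mul_integral _ hs (integrable_exp_compoundPoisson hint) z).trans ?_
  rw [integral_exp_compoundPoisson hint, ← Real.exp_add]
  exact Real.exp_le_exp.2 (by linarith)

end Approx

/-! ### Tail bounds for the symmetric stable law -/

section Stable

variable {Ω : Type*} [MeasurableSpace Ω] {P : Measure Ω} {α : ℝ} {X : Ω → ℝ}

theorem IsSymmetricStable.tendsto_charFun (hα : α ∈ Ioo (1 : ℝ) 2) (hX : IsSymmetricStable P α X)
    (t : ℝ) :
    Tendsto (fun n : ℕ => charFun (compoundPoisson (levyTail α (1 / (n + 1)))) t) atTop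
      (𝓝 (charFun (P.map X) t)) := by
  rw [hX.charFun_eq t]
  exact tendsto_charFun_compoundPoisson_levyTail hα t

theorem IsSymmetricStable.real_le_eq (hX : IsSymmetricStable P α X) (a : ℝ) :
    P.real {ω | a ≤ X ω} = (P.map X).real (Ici a) := by
  rw [measureReal_def, measureReal_def, Measure.map_apply_of_aemeasurable hX.aemeasurable
    measurableSet_Ici]
  rfl

theorem isProbabilityMeasure_compoundPoisson_levyTail (hα : α ∈ Ioo (1 : ℝ) 2) (n : ℕ) :
    IsProbabilityMeasure (compoundPoisson (levyTail α (1 / ((n : ℝ) + 1)))) := by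
  have := isFiniteMeasure_restrict_levy (α := α) (by linarith [hα.1])
    (Nat.one_div_pos_of_nat (α := ℝ) (n := n)) (Subset.refl (abs ⁻¹' Ioi (1 / ((n : ℝ) + 1))))
  infer_instance

theorem eventually_one_div_add_one_le {R : ℝ} (hR : 0 < R) :
    ∀ᶠ n : ℕ in atTop, 1 / ((n : ℝ) + 1) ≤ R :=
  (tendsto_one_div_add_atTop_nhds_zero_nat (𝕜 := ℝ)).eventually_le_const hR

theorem IsSymmetricStable.real_le_upper [IsProbabilityMeasure P] (hα : α ∈ Ioo (1 : ℝ) 2) (hX : IsSymmetricStable P α X)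
    {R : ℝ} (hR : 0 < R) {s : ℝ} (hs : 0 ≤ s) (z : ℝ) :
    P.real {ω | z ≤ X ω} ≤ R ^ (-α) / α +
      Real.exp (-(s * z) + (s ^ 2 * (R ^ (2 - α) / (2 - α)) +
        2 * (Real.cosh (s * R) - 1 - (s * R) ^ 2 / 2) * R ^ (-α) / (4 - α))) := by
  have := isProbabilityMeasure_compoundPoisson_levyTail hα
  have := Measure.isProbabilityMeasure_map (μ := P) hX.aemeasurable
  rw [hX.real_le_eq]
  refine real_Ici_le_of_tendsto_charFun (hX.tendsto_charFun hα) (B := fun z => R ^ (-α) / α +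
      Real.exp (-(s * z) + (s ^ 2 * (R ^ (2 - α) / (2 - α)) +
        2 * (Real.cosh (s * R) - 1 - (s * R) ^ 2 / 2) * R ^ (-α) / (4 - α)))) ?_ (by fun_prop)
  filter_upwards [eventually_one_div_add_one_le hR] with n hn z
  exact real_Ici_compoundPoisson_levyTail_le hα Nat.one_div_pos_of_nat hn hs z

theorem IsSymmetricStable.le_real_le_of_jump [IsProbabilityMeasure P] (hα : α ∈ Ioo (1 : ℝ) 2)
    (hX : IsSymmetricStable P α X) {y : ℝ} (hy : 0 < y) :
    1 / 2 * (1 / (2 + α * y ^ α)) ≤ P.real {ω | y ≤ X ω} := by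
  have hα0 : 0 < α := by linarith [hα.1]
  have := isProbabilityMeasure_compoundPoisson_levyTail hα
  have := Measure.isProbabilityMeasure_map (μ := P) hX.aemeasurable
  rw [hX.real_le_eq]
  have h1 : 1 / 4 * (1 - Real.exp (-(2 * (y ^ (-α) / α)))) ≤ (P.map X).real (Ici y) := by
    refine le_real_Ici_of_tendsto_charFun (hX.tendsto_charFun hα) ?_ tendsto_const_nhds
    filter_upwards [eventually_one_div_add_one_le hy] with n hn
    exact le_real_Ici_compoundPoisson_levyTail hα0 Nat.one_div_pos_of_nat hn
  refine le_trans ?_ h1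
  have hz : 0 < y ^ α := by positivity
  rw [Real.rpow_neg hy.le]
  set L := 2 * ((y ^ α)⁻¹ / α) with hL
  have hLpos : 0 < L := by positivity
  have h2 : Real.exp (-L) ≤ 1 / (1 + L) := by
    rw [Real.exp_neg, ← one_div]
    exact one_div_le_one_div_of_le (by linarith) (by linarith [Real.add_one_le_exp L])
  have h3 : 1 / 2 * (1 / (2 + α * y ^ α)) = 1 / 4 * (1 - 1 / (1 + L)) := by
    rw [hL]
    field_simp
    ring
  rw [h3]
  linarith

/-- The strict inequality leaves room for the truncation: the approximating variances `v n` converge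
to `s²/(2-α)` and so eventually exceed `s * a`. -/
theorem IsSymmetricStable.le_real_le_of_small_jumps [IsProbabilityMeasure P] (hα : α ∈ Ioo (1 : ℝ) 2)
    (hX : IsSymmetricStable P α X) {s a : ℝ} (hs : 0 < s) (hsa : s * a < s ^ 2 / (2 - α)) :
    1 / 2 * ((1 - Real.exp (-(s ^ 2 / (2 - α) - s * a))) ^ 2 * Real.exp (-(2 * s ^ 2 / (2 - α) +
        (Real.cosh (2 * s) - 1 - (2 * s) ^ 2 / 2)))) ≤ P.real {ω | a ≤ X ω} := by
  have hα0 : 0 < α := by linarith [hα.1]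
  have hε : 0 < 2 - α := by linarith [hα.2]
  have := isProbabilityMeasure_compoundPoisson_levyTail hα
  have := Measure.isProbabilityMeasure_map (μ := P) hX.aemeasurable
  rw [hX.real_le_eq]
  set v : ℕ → ℝ := fun n => s ^ 2 * ((1 - (1 / ((n : ℝ) + 1)) ^ (2 - α)) / (2 - α)) with hv
  set g := Real.cosh (2 * s) - 1 - (2 * s) ^ 2 / 2
  have hvlim : Tendsto v atTop (𝓝 (s ^ 2 / (2 - α))) := by
    have h0 := (tendsto_one_div_add_atTop_nhds_zero_nat (𝕜 := ℝ)).rpow_const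
      (p := 2 - α) (Or.inr hε.le)
    rw [Real.zero_rpow hε.ne'] at h0
    have h1 := ((h0.const_sub 1).div_const (2 - α)).const_mul (s ^ 2)
    convert h1 using 2
    ring
  have hlim : Tendsto (fun n => 1 / 2 * ((1 - Real.exp (-(v n - s * a))) ^ 2 *
      Real.exp (2 * v n - (4 * s ^ 2 / (2 - α) + g)))) atTop
      (𝓝 (1 / 2 * ((1 - Real.exp (-(s ^ 2 / (2 - α) - s * a))) ^ 2 *
        Real.exp (-(2 * s ^ 2 / (2 - α) + g))))) := by
    have hc : Continuous fun w : ℝ => 1 / 2 * ((1 - Real.exp (-(w - s * a))) ^ 2 *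
      Real.exp (2 * w - (4 * s ^ 2 / (2 - α) + g))) := by fun_prop
    have h := (hc.tendsto (s ^ 2 / (2 - α))).comp hvlim
    have hlast : -(2 * s ^ 2 / (2 - α) + g) =
        2 * (s ^ 2 / (2 - α)) - (4 * s ^ 2 / (2 - α) + g) := by ring
    rw [hlast]
    exact h
  refine le_real_Ici_of_tendsto_charFun (hX.tendsto_charFun hα) ?_ hlim
  filter_upwards [eventually_one_div_add_one_le one_pos, hvlim.eventually_const_le hsa] with n hn hvn
  refine le_trans ?_ (half_mul_real_Ici_levyAnnulus_le hα0 Nat.one_div_pos_of_nat hn a)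
  exact mul_le_mul_of_nonneg_left
    (paley_zygmund_levyAnnulus hα Nat.one_div_pos_of_nat hn hs rfl hvn) (by norm_num)

end Stable

/-! ### Numerical estimates -/

theorem log_le_div_exp_one {a : ℝ} (ha : 0 < a) : Real.log a ≤ a / Real.exp 1 := by
  have h := Real.log_le_sub_one_of_pos (div_pos ha (Real.exp_pos 1))
  rw [Real.log_div ha.ne' (Real.exp_pos 1).ne', Real.log_exp] at h
  linarith

/-- Since `log x ≤ x/e`, the left side is at most `e^{2/e}`; `92/125` is a rational just above
`2/e`, and `33/125 = 1 - 92/125`. -/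
theorem two_div_rpow_self_le {ε : ℝ} (hε : 0 < ε) : (2 / ε) ^ ε ≤ 21 / 10 := by
  have hpos : 0 < 2 / ε := by positivity
  have he := Real.exp_one_gt_d9
  have he' := Real.exp_one_lt_d9
  have h1 : Real.log (2 / ε) * ε ≤ 92 / 125 := by
    calc Real.log (2 / ε) * ε ≤ 2 / ε / Real.exp 1 * ε := by
          gcongr
          exact log_le_div_exp_one hpos
      _ = 2 / Real.exp 1 := by field_simp
      _ ≤ 92 / 125 := by
          rw [div_le_div_iff₀ (Real.exp_pos 1) (by norm_num)]
          linarith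
  rw [Real.rpow_def_of_pos hpos]
  refine (Real.exp_le_exp.2 h1).trans ?_
  have h2 := Real.quadratic_le_exp_of_nonneg (x := 33 / 125) (by norm_num)
  have h3 : Real.exp (92 / 125) * Real.exp (33 / 125) = Real.exp 1 := by
    rw [← Real.exp_add]
    norm_num
  nlinarith [Real.exp_pos (92 / 125)]

theorem exp_one_half_le : Real.exp (1 / 2) ≤ 7 / 3 := by
  have h : Real.exp (1 / 2) * Real.exp (1 / 2) = Real.exp 1 := by
    rw [← Real.exp_add]
    norm_num
  have he := Real.exp_one_lt_d9
  nlinarith [Real.exp_pos (1 / 2)]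

theorem cosh_sub_le_half_exp {u : ℝ} (hu : 0 ≤ u) :
    Real.cosh u - 1 - u ^ 2 / 2 ≤ Real.exp u / 2 := by
  rw [Real.cosh_eq]
  have : Real.exp (-u) ≤ 1 := Real.exp_le_one_iff.2 (by linarith)
  nlinarith [sq_nonneg u]

theorem cosh_two_sub_le : Real.cosh 2 - 1 - 2 ^ 2 / 2 ≤ 4 / 5 := by
  have h2 : Real.exp 2 = Real.exp 1 * Real.exp 1 := by
    rw [← Real.exp_add]
    norm_num
  have h3 : Real.exp (-2) * Real.exp 2 = 1 := by
    rw [← Real.exp_add]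
    norm_num
  have he := Real.exp_one_gt_d9
  have he' := Real.exp_one_lt_d9
  have h4 : Real.exp 2 ≤ 7.39 := by rw [h2]; nlinarith
  have h5 : 7.38 ≤ Real.exp 2 := by rw [h2]; nlinarith
  have h6 : Real.exp (-2) ≤ 0.136 := by nlinarith [Real.exp_pos (-2)]
  rw [Real.cosh_eq]
  linarith

/-- At the endpoint `z₀ = (2/ε)^α` one has `ε z₀ ≥ 4/(2.1 ε)`, whereas `log z₀ ≤ 2 log (2/ε) ≤ 4/(e
ε)`. Beyond it the logarithm has slope at most `1/z₀ ≤ ε`. -/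
theorem log_le_mul_rpow {α y : ℝ} (hα : α ∈ Ioo (1 : ℝ) 2) (hy : 2 / (2 - α) ≤ y) :
    Real.log (y ^ α) ≤ (2 - α) * y ^ α := by
  have hε : 0 < 2 - α := by linarith [hα.2]
  have hε1 : 2 - α < 1 := by linarith [hα.1]
  set ε := 2 - α with hεd
  have hw : 0 < 2 / ε := by positivity
  have hy0 : 0 < y := hw.trans_le hy
  set z₀ := (2 / ε) ^ α with hz₀
  have hz₀pos : 0 < z₀ := by positivity
  have hz : z₀ ≤ y ^ α := Real.rpow_le_rpow hw.le hy (by linarith [hα.1])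
  have hprod : z₀ * (2 / ε) ^ ε = (2 / ε) ^ 2 := by
    rw [hz₀, ← Real.rpow_add hw, ← Real.rpow_natCast]
    congr 1
    rw [hεd]
    push_cast
    ring
  have hlow : 4 / (21 / 10 * ε) ≤ ε * z₀ := by
    have h1 := two_div_rpow_self_le hε
    have h2 : (2 / ε) ^ 2 ≤ z₀ * (21 / 10) := by
      rw [← hprod]
      gcongr
    rw [div_pow, div_le_iff₀ (by positivity)] at h2
    rw [div_le_iff₀ (by positivity)]
    nlinarith
  have hone : 1 ≤ ε * z₀ := by
    refine le_trans ?_ hlow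
    rw [le_div_iff₀ (by positivity)]
    linarith
  have hlog₀ : Real.log z₀ ≤ ε * z₀ := by
    refine le_trans ?_ hlow
    rw [hz₀, Real.log_rpow hw]
    have h1 := log_le_div_exp_one hw
    have h2 : 0 ≤ Real.log (2 / ε) := Real.log_nonneg (by rw [le_div_iff₀ hε]; linarith)
    have he := Real.exp_one_gt_d9
    calc α * Real.log (2 / ε) ≤ 2 * (2 / ε / Real.exp 1) := by
          gcongr
          exact hα.2.le
      _ = 4 / (Real.exp 1 * ε) := by field_simp; norm_num
      _ ≤ 4 / (21 / 10 * ε) := by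
          gcongr
          linarith
  have hratio := Real.log_le_sub_one_of_pos (div_pos (hz₀pos.trans_le hz) hz₀pos)
  rw [Real.log_div (hz₀pos.trans_le hz).ne' hz₀pos.ne'] at hratio
  have hinv : y ^ α / z₀ - 1 ≤ ε * (y ^ α - z₀) := by
    rw [div_sub_one hz₀pos.ne', div_le_iff₀ hz₀pos]
    nlinarith
  linarith

/-! ### The tail bounds -/

section Bounds

variable {Ω : Type*} [MeasurableSpace Ω] {P : Measure Ω} [IsProbabilityMeasure P] {α : ℝ}
  {X : Ω → ℝ}

theorem IsSymmetricStable.real_two_mul_le (hα : α ∈ Ioo (1 : ℝ) 2) (hX : IsSymmetricStable P α X)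
    {y u : ℝ} (hy : 0 < y) (hu : 0 ≤ u) :
    P.real {ω | 2 * y ≤ X ω} ≤ 1 / y ^ α +
      Real.exp (-(2 * u) + u ^ 2 / ((2 - α) * y ^ α) + Real.exp u / (2 * y ^ α)) := by
  have hε : 0 < 2 - α := by linarith [hα.2]
  have hz : 0 < y ^ α := by positivity
  refine (hX.real_le_upper hα hy (s := u / y) (by positivity) (2 * y)).trans ?_
  rw [Real.rpow_neg hy.le, Real.rpow_sub hy, Real.rpow_two]
  refine add_le_add ?_ (Real.exp_le_exp.2 ?_)
  · rw [← one_div]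
    exact div_le_self (by positivity) hα.1.le
  · have h1 : u / y * (2 * y) = 2 * u := by field_simp
    have h2 : u / y * y = u := by field_simp
    have h3 : (u / y) ^ 2 * (y ^ 2 / y ^ α / (2 - α)) = u ^ 2 / ((2 - α) * y ^ α) := by field_simp
    rw [h1, h2, h3, add_assoc]
    refine add_le_add le_rfl (add_le_add le_rfl ?_)
    have hg := cosh_sub_le_half_exp hu
    have hg0 := cosh_sub_nonneg u
    set g := Real.cosh u - 1 - u ^ 2 / 2
    calc 2 * g * (y ^ α)⁻¹ / (4 - α) ≤ 2 * g * (y ^ α)⁻¹ / 2 := by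
          gcongr
          linarith
      _ = g / y ^ α := by field_simp
      _ ≤ Real.exp u / 2 / y ^ α := by gcongr
      _ = _ := by rw [div_div]

theorem IsSymmetricStable.real_two_mul_le_of_log (hα : α ∈ Ioo (1 : ℝ) 2)
    (hX : IsSymmetricStable P α X) {y : ℝ} (hy : 1 ≤ y)
    (hlog : Real.log (y ^ α) ≤ (2 - α) * y ^ α) :
    P.real {ω | 2 * y ≤ X ω} ≤ 10 / 3 * (1 / y ^ α) := by
  have hε : 0 < 2 - α := by linarith [hα.2]
  have hz1 : 1 ≤ y ^ α := Real.one_le_rpow hy (by linarith [hα.1])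
  have hz : 0 < y ^ α := by linarith
  have hu : 0 ≤ Real.log (y ^ α) := Real.log_nonneg hz1
  refine (hX.real_two_mul_le hα (by linarith : 0 < y) hu).trans ?_
  rw [Real.exp_log hz]
  set u := Real.log (y ^ α) with hu_def
  -- The exponent is then at most `-u + 1/2`; `7/3` bounds `√e`, and the big-jump term raises it to
  -- `10/3`.
  have h1 : u ^ 2 / ((2 - α) * y ^ α) ≤ u := by
    rw [div_le_iff₀ (by positivity), sq]
    gcongr
  have h2 : y ^ α / (2 * y ^ α) = 1 / 2 := by field_simp
  have h3 : Real.exp (-(2 * u) + u ^ 2 / ((2 - α) * y ^ α) + y ^ α / (2 * y ^ α)) ≤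
      7 / 3 * (1 / y ^ α) := by
    calc _ ≤ Real.exp (1 / 2 + -u) := by rw [h2]; exact Real.exp_le_exp.2 (by linarith)
      _ = Real.exp (1 / 2) * (1 / y ^ α) := by
          rw [Real.exp_add, Real.exp_neg, hu_def, Real.exp_log hz, one_div (y ^ α)]
      _ ≤ _ := by
          gcongr
          exact exp_one_half_le
  linarith

theorem IsSymmetricStable.real_two_mul_le_of_gaussian (hα : α ∈ Ioo (1 : ℝ) 2)
    (hX : IsSymmetricStable P α X) {y : ℝ} (hy : 1 ≤ y) (hT : 4 ≤ (2 - α) * y ^ 2)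
    (hy2 : y ≤ 2 / (2 - α)) :
    P.real {ω | 2 * y ≤ X ω} ≤
      10 / 3 * (1 / y ^ α) + Real.exp (2 / 45) * Real.exp (-(1 / 4) * (2 - α) * y ^ 2) := by
  have hε : 0 < 2 - α := by linarith [hα.2]
  have hy0 : 0 < y := by linarith
  have hz : 0 < y ^ α := by positivity
  have hprod : y ^ α * y ^ (2 - α) = y ^ 2 := by
    rw [← Real.rpow_add hy0, add_sub_cancel, Real.rpow_two]
  have hK : y ^ (2 - α) ≤ 21 / 10 :=
    (Real.rpow_le_rpow hy0.le hy2 hε.le).trans (two_div_rpow_self_le hε)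
  have hyz : y ^ 2 ≤ 21 / 10 * y ^ α := by
    rw [← hprod, mul_comm]
    gcongr
  set T := (2 - α) * y ^ 2 with hTd
  have hTz : T ≤ 21 / 10 * ((2 - α) * y ^ α) := by
    rw [hTd]
    nlinarith
  -- With `u = T/4` the exponent is at most `-T/2 + 21T/160 + 1/2`, which is below `-T/4 + 2/45`
  -- because `T ≥ 4`. Otherwise `log y^α ≤ T/4 ≤ (2-α)y^α` and the logarithmic choice applies.
  rcases le_total (T / 4) (Real.log (y ^ α)) with h | h
  · refine (hX.real_two_mul_le hα hy0 (u := T / 4) (by linarith)).trans ?_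
    have h1 : (T / 4) ^ 2 / ((2 - α) * y ^ α) ≤ 21 / 160 * T := by
      rw [div_le_iff₀ (by positivity)]
      nlinarith
    have h2 : Real.exp (T / 4) / (2 * y ^ α) ≤ 1 / 2 := by
      have := (Real.le_log_iff_exp_le hz).1 h
      rw [div_le_iff₀ (by positivity)]
      linarith
    have h3 : 1 / y ^ α ≤ 10 / 3 * (1 / y ^ α) := by
      have : 0 < 1 / y ^ α := by positivity
      linarith
    refine add_le_add h3 ?_
    rw [← Real.exp_add]
    refine Real.exp_le_exp.2 ?_
    have h4 : -(1 / 4) * (2 - α) * y ^ 2 = -(T / 4) := by rw [hTd]; ring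
    rw [h4]
    linarith
  · refine (hX.real_two_mul_le_of_log hα hy (by linarith)).trans ?_
    have : 0 < Real.exp (2 / 45) * Real.exp (-(1 / 4) * (2 - α) * y ^ 2) := by positivity
    linarith

theorem IsSymmetricStable.gaussian_le_real (hα : α ∈ Ioo (1 : ℝ) 2) (hX : IsSymmetricStable P α X)
    {y : ℝ} (hy : 0 < y) (hT : 4 ≤ (2 - α) * y ^ 2) (hy2 : y ≤ 2 / (2 - α)) :
    9 / 100 * Real.exp (-(2 - α) * y ^ 2) ≤ P.real {ω | Real.sqrt 2 / 4 * y ≤ X ω} := by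
  have hε : 0 < 2 - α := by linarith [hα.2]
  have hr0 : 0 ≤ Real.sqrt 2 := Real.sqrt_nonneg 2
  have hr2 : Real.sqrt 2 ^ 2 = 2 := Real.sq_sqrt (by norm_num)
  have hr : Real.sqrt 2 ≤ 1.4144 := by nlinarith
  have hεy : (2 - α) * y ≤ 2 := by rwa [le_div_iff₀' hε] at hy2
  -- Here `y ≤ 2/(2-α)` gives `s ≤ 1`, which keeps the `cosh` remainder at `2s` below `4/5`.
  set s := (2 - α) * y / 2 with hs
  set T := (2 - α) * y ^ 2 with hTd
  have hspos : 0 < s := by positivity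
  have hs1 : |s| ≤ 1 := by rw [abs_of_pos hspos]; linarith
  have hss : s ^ 2 / (2 - α) = T / 4 := by rw [hs, hTd]; field_simp; norm_num
  have hsa : s * (Real.sqrt 2 / 4 * y) = Real.sqrt 2 / 8 * T := by rw [hs, hTd]; ring
  -- `T ≥ 4` and `√2 ≤ 1.4144` give the margin `1 - 0.7072`.
  have hη : 0.2928 ≤ T / 4 - Real.sqrt 2 / 8 * T := by nlinarith
  have hmain := hX.le_real_le_of_small_jumps hα hspos (a := Real.sqrt 2 / 4 * y)
    (by rw [hss, hsa]; linarith)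
  refine le_trans ?_ hmain
  rw [mul_div_assoc, hss, hsa]
  have hg : Real.cosh (2 * s) - 1 - (2 * s) ^ 2 / 2 ≤ 4 / 5 := by
    rw [mul_comm 2 s]
    refine (cosh_mul_sub_le hs1 2).trans ?_
    have h1 : s ^ 4 ≤ 1 := pow_le_one₀ hspos.le ((le_abs_self s).trans hs1)
    have h2 := cosh_sub_nonneg 2
    have h3 := cosh_two_sub_le
    nlinarith
  have hA : 1 / 4 ≤ 1 - Real.exp (-(T / 4 - Real.sqrt 2 / 8 * T)) := by
    have h1 : Real.exp (-(T / 4 - Real.sqrt 2 / 8 * T)) ≤ Real.exp (-0.2928) :=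
      Real.exp_le_exp.2 (by linarith)
    have h2 := Real.quadratic_le_exp_of_nonneg (x := 0.2928) (by norm_num)
    have h3 : Real.exp (-0.2928) * Real.exp 0.2928 = 1 := by
      rw [← Real.exp_add]
      norm_num
    nlinarith [Real.exp_pos (-0.2928)]
  -- `T ≥ 4` turns `-T/2 - 4/5` into at least `-T + 6/5`.
  have hB : 72 / 25 * Real.exp (-T) ≤ Real.exp (-(2 * (T / 4) +
      (Real.cosh (2 * s) - 1 - (2 * s) ^ 2 / 2))) := by
    have h1 : (72 / 25 : ℝ) ≤ Real.exp (6 / 5) := by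
      have := Real.quadratic_le_exp_of_nonneg (x := 6 / 5) (by norm_num)
      linarith
    calc 72 / 25 * Real.exp (-T) ≤ Real.exp (6 / 5) * Real.exp (-T) := by gcongr
      _ = Real.exp (6 / 5 + -T) := (Real.exp_add _ _).symm
      _ ≤ _ := Real.exp_le_exp.2 (by linarith)
  have hA2 : (1 / 4) ^ 2 ≤ (1 - Real.exp (-(T / 4 - Real.sqrt 2 / 8 * T))) ^ 2 := by gcongr
  have hneg : -(2 - α) * y ^ 2 = -T := by rw [hTd]; ring
  rw [hneg]
  calc 9 / 100 * Real.exp (-T) = 1 / 2 * ((1 / 4) ^ 2 * (72 / 25 * Real.exp (-T))) := by ring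
    _ ≤ _ := by gcongr

theorem IsSymmetricStable.one_div_rpow_le_real (hα : α ∈ Ioo (1 : ℝ) 2)
    (hX : IsSymmetricStable P α X) {y : ℝ} (hy : 2 ≤ y) :
    1 / 4 * (1 / y ^ α) ≤ P.real {ω | Real.sqrt 2 / 4 * y ≤ X ω} := by
  have hr0 : 0 < Real.sqrt 2 := Real.sqrt_pos.2 (by norm_num)
  have hr2 : Real.sqrt 2 ^ 2 = 2 := Real.sq_sqrt (by norm_num)
  have hr : Real.sqrt 2 ≤ 2 := by nlinarith
  have hy0 : 0 < y := by linarith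
  refine le_trans ?_ (hX.le_real_le_of_jump hα (y := Real.sqrt 2 / 4 * y) (by positivity))
  have hz : 2 ≤ y ^ α := by
    calc (2 : ℝ) ≤ y ^ (1 : ℝ) := by simpa using hy
      _ ≤ y ^ α := Real.rpow_le_rpow_of_exponent_le (by linarith) hα.1.le
  have h1 : (Real.sqrt 2 / 4 * y) ^ α ≤ 1 / 2 * y ^ α := by
    rw [Real.mul_rpow (by positivity) hy0.le]
    gcongr
    calc (Real.sqrt 2 / 4) ^ α ≤ (Real.sqrt 2 / 4) ^ (1 : ℝ) :=
          Real.rpow_le_rpow_of_exponent_ge (by positivity) (by linarith) hα.1.le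
      _ ≤ 1 / 2 := by rw [Real.rpow_one]; linarith
  have h2 : α * (Real.sqrt 2 / 4 * y) ^ α ≤ y ^ α := by
    calc α * (Real.sqrt 2 / 4 * y) ^ α ≤ 2 * (1 / 2 * y ^ α) := by
          gcongr
          exact hα.2.le
      _ = y ^ α := by ring
  have h3 : 0 ≤ α * (Real.sqrt 2 / 4 * y) ^ α := mul_nonneg (by linarith [hα.1]) (by positivity)
  calc 1 / 4 * (1 / y ^ α) = 1 / 2 * (1 / (2 * y ^ α)) := by field_simp; norm_num
    _ ≤ _ := by
      gcongr
      linarith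

theorem IsSymmetricStable.le_real_of_gaussian (hα : α ∈ Ioo (1 : ℝ) 2)
    (hX : IsSymmetricStable P α X) {y : ℝ} (hy : 2 ≤ y) (hT : 4 ≤ (2 - α) * y ^ 2)
    (hy2 : y ≤ 2 / (2 - α)) :
    1 / (6 * Real.exp 5) * (1 / y ^ α) + 1 / (6 * Real.exp 1) * Real.exp (-(2 - α) * y ^ 2) ≤
      P.real {ω | Real.sqrt 2 / 4 * y ≤ X ω} := by
  have hy0 : 0 < y := by linarith
  have h1 := hX.gaussian_le_real hα hy0 hT hy2
  have h2 := hX.one_div_rpow_le_real hα hy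
  -- The two lower bounds are averaged with weights `9/10` (Gaussian) and `1/10` (single jump).
  have he : 1 / (6 * Real.exp 1) ≤ 9 / 10 * (9 / 100) := by
    rw [div_le_iff₀ (by positivity)]
    linarith [Real.exp_one_gt_d9]
  have he5 : 1 / (6 * Real.exp 5) ≤ 1 / 10 * (1 / 4) := by
    rw [div_le_iff₀ (by positivity)]
    linarith [Real.quadratic_le_exp_of_nonneg (x := 5) (by norm_num)]
  have h3 : 1 / (6 * Real.exp 5) * (1 / y ^ α) ≤ 1 / 10 * (1 / 4) * (1 / y ^ α) := by gcongr
  have h4 : 1 / (6 * Real.exp 1) * Real.exp (-(2 - α) * y ^ 2) ≤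
      9 / 10 * (9 / 100) * Real.exp (-(2 - α) * y ^ 2) := by gcongr
  linarith

end Bounds

theorem theorem19 {Ω : Type*} [MeasurableSpace Ω] (P : Measure Ω) [IsProbabilityMeasure P]
    (α : ℝ) (hα : α ∈ Set.Ioo (1 : ℝ) 2) (X : Ω → ℝ) (hX : IsSymmetricStable P α X) :
    (∀ y ∈ Set.Icc (2 / Real.sqrt (2 - α)) (2 / (2 - α)),
      P.real {ω | 2 * y ≤ X ω} ≤
          10 / 3 * (1 / y ^ α) + Real.exp (2 / 45) * Real.exp (-(1 / 4) * (2 - α) * y ^ 2) ∧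
      1 / (6 * Real.exp 5) * (1 / y ^ α)
          + 1 / (6 * Real.exp 1) * Real.exp (-(2 - α) * y ^ 2) ≤
        P.real {ω | Real.sqrt 2 / 4 * y ≤ X ω}) ∧
    (∀ y : ℝ, 2 / (2 - α) ≤ y →
      P.real {ω | 2 * y ≤ X ω} ≤ 16 / 3 * (1 / y ^ α) ∧
      1 / 2 * (1 / (2 + α * y ^ α)) ≤ P.real {ω | y ≤ X ω}) := by
  have hε : 0 < 2 - α := by linarith [hα.2]
  have hε1 : 2 - α ≤ 1 := by linarith [hα.1]
  refine ⟨fun y hy => ?_, fun y hy => ?_⟩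
  · have hr : 0 < Real.sqrt (2 - α) := Real.sqrt_pos.2 hε
    have hr1 : Real.sqrt (2 - α) ≤ 1 := Real.sqrt_le_one.2 hε1
    have hr2 : Real.sqrt (2 - α) ^ 2 = 2 - α := Real.sq_sqrt hε.le
    have h1 : 2 ≤ y * Real.sqrt (2 - α) := (div_le_iff₀ hr).1 hy.1
    have hy2 : 2 ≤ y := by
      refine le_trans ?_ hy.1
      rw [le_div_iff₀ hr]
      linarith
    have hT : 4 ≤ (2 - α) * y ^ 2 := by
      rw [← hr2, ← mul_pow, mul_comm]
      nlinarith
    exact ⟨hX.real_two_mul_le_of_gaussian hα (by linarith) hT hy.2,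
      hX.le_real_of_gaussian hα hy2 hT hy.2⟩
  · have hy1 : 1 ≤ y := by
      refine le_trans ?_ hy
      rw [le_div_iff₀ hε]
      linarith
    refine ⟨(hX.real_two_mul_le_of_log hα hy1 (log_le_mul_rpow hα hy)).trans ?_,
      hX.le_real_le_of_jump hα (by linarith)⟩
    have : 0 < 1 / y ^ α := by positivity
    linarith
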